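/- **Setting.** Let $\mathbb K\in\{\mathbb R,\mathbb C\}$, let $\Omega$ be a locally compact Hausdorff space, and let $\varphi\colon\Omega\to\Omega$ be a homeomorphism. Write $C_0(\Omega)$ for the Banach algebra of continuous $\mathbb K$-valued functions on $\Omega$ vanishing at infinity, and $U_0(\Omega)$ for the set of upper semicontinuous functions $f\colon\Omega\to\mathbb R$ vanishing at infinity (for every $\varepsilon>0$ there is a compact $K\subset\Omega$ with $|f|\le\varepsilon$ off $K$). For $f\in C_0(\Omega)$ or $f\in U_0(\Omega)$ put $T_\varphi f:=f\circ\varphi^{-1}$. A *Banach module* over $C_0(\Omega)$ is a Banach space $\Gamma$ over $\mathbb K$ with a bilinear associative action of $C_0(\Omega)$ such that $\|fs\|\le\|f\|\,\|s\|$ and such that the linear span of $\{fs \mid f\in C_0(\Omega),\,s\in\Gamma\}$ is dense in $\Gamma$. For $s\in\Gamma$, $$\operatorname{supp}(s):=\{x\in\Omega \mid fs\neq 0 \text{ for every } f\in C_0(\Omega) \text{ with } f(x)\neq 0\}.$$ A *$U_0(\Omega)$-normed module* is a Banach module $\Gamma$ over $C_0(\Omega)$ together with a map $|\cdot|$ from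 $\Gamma$ to the nonnegative functions in $U_0(\Omega)$ such that $\sup_{x\in\Omega}|s|(x)=\|s\|$, $|fs|=|f|\cdot|s|$ and $|s_1+s_2|\le|s_1|+|s_2|$ for all $f\in C_0(\Omega)$ and $s,s_1,s_2\in\Gamma$ (the supremum over $\Omega=\emptyset$ being $0$, here and below). A *Banach bundle* over $\Omega$ is a topological space $E$ with a continuous open surjection $p\colon E\to\Omega$ such that each fiber $E_x=p^{-1}(x)$ is a Banach space over $\mathbb K$, addition $E\times_\Omega E\to E$ and scalar multiplication $\mathbb K\times E\to E$ are continuous, $v\mapsto\|v\|$ is upper semicontinuous on $E$, and for each $x\in\Omega$ and each open $W\subset E$ containing the zero $0_x$ of $E_x$ there are $\varepsilon>0$ and an open neighborhood $U$ of $x$ with $\{v\in p^{-1}(U) \mid \|v\|\le\varepsilon\}\subset W$. The space $\Gamma_0(E)$ of continuous sections $s$ of $E$ for which $x\mapsto\|s(x)\|$ vanishes at infinity, with pointwise operations, the norm $\|s\|=\sup_{x}\|s(x)\|$ and $|s|(x):=\|s(x)\|$, is a $U_0(\Omega)$-normed module. A *morphism over $\varphi$* from $E$ to $F$ is a continuous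 map $\Phi\colon E\to F$ with $p_F\circ\Phi=\varphi\circ p_E$ that restricts to a bounded linear operator $\Phi|_{E_x}\colon E_x\to F_{\varphi(x)}$ for each $x\in\Omega$ and satisfies $\|\Phi\|:=\sup_{x\in\Omega}\|\Phi|_{E_x}\|<\infty$; it is *isometric* if every $\Phi|_{E_x}$ is an isometry (not necessarily surjective). It induces the bounded operator $\mathcal T_\Phi\colon\Gamma_0(E)\to\Gamma_0(F)$, $\mathcal T_\Phi s:=\Phi\circ s\circ\varphi^{-1}$. **Theorem.** Let $\Gamma$ and $\Lambda$ be $U_0(\Omega)$-normed modules and let $\mathcal T\colon\Gamma\to\Lambda$ be a bounded linear operator. The following are equivalent. (a) $\mathcal T(fs)=T_\varphi f\cdot\mathcal Ts$ for all $f\in C_0(\Omega)$ and $s\in\Gamma$. (b) $\operatorname{supp}(\mathcal Ts)\subset\varphi(\operatorname{supp}(s))$ for every $s\in\Gamma$. (c) $|\mathcal Ts|\le\|\mathcal T\|\cdot T_\varphi|s|$ for every $s\in\Gamma$. (d) There is $m>0$ such that $|\mathcal Ts|\le m\cdot T_\varphi|s|$ for every $s\in\Gamma$. Moreover, if $\Gamma=\Gamma_0(E)$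 and $\Lambda=\Gamma_0(F)$ for Banach bundles $E$ and $F$ over $\Omega$, then (a)–(d) are also equivalent to (e) There is a morphism $\Phi$ over $\varphi$ from $E$ to $F$ with $\mathcal T=\mathcal T_\Phi$. If (e) holds, then the morphism $\Phi$ in (e) is unique, $\|\Phi\|=\|\mathcal T\|$, and $\Phi$ is isometric if and only if $\mathcal T$ is isometric. -/

import Mathlib

open scoped ZeroAtInfty

universe u v w

/-! ### Banach modules over a commutative Banach algebra -/

/-- A (non-degenerate) Banach module over a commutative Banach algebra `A` over `𝕜`. The algebra
`A` need not have a unit, so the module axioms are listed explicitly. -/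
class IsBanachModule (𝕜 : Type*) (A : Type*) (Γ : Type*) [RCLike 𝕜]
    [NonUnitalNormedCommRing A] [NormedSpace 𝕜 A]
    [NormedAddCommGroup Γ] [NormedSpace 𝕜 Γ] [SMul A Γ] : Prop where
  complete : CompleteSpace Γ
  smul_add : ∀ (f : A) (s t : Γ), f • (s + t) = f • s + f • t
  add_smul : ∀ (f g : A) (s : Γ), (f + g) • s = f • s + g • s
  mul_smul : ∀ (f g : A) (s : Γ), (f * g) • s = f • (g • s)
  scalar_smul : ∀ (c : 𝕜) (f : A) (s : Γ), (c • f) • s = c • (f • s)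
  smul_scalar : ∀ (c : 𝕜) (f : A) (s : Γ), f • (c • s) = c • (f • s)
  norm_smul_le : ∀ (f : A) (s : Γ), ‖f • s‖ ≤ ‖f‖ * ‖s‖
  nondegenerate :
    (Submodule.span 𝕜 (Set.range fun p : A × Γ => p.1 • p.2)).topologicalClosure = ⊤

/-! ### Upper semicontinuous functions vanishing at infinity -/

/-- `U₀(Ω)`: upper semicontinuous functions `Ω → ℝ` vanishing at infinity. -/
structure U0 (Ω : Type*) [TopologicalSpace Ω] where
  toFun : Ω → ℝ
  usc : UpperSemicontinuous toFun
  vanish : ∀ ε : ℝ, 0 < ε → ∃ K : Set Ω, IsCompact K ∧ ∀ x, x ∉ K → |toFun x| ≤ ε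

instance U0.instCoeFun {Ω : Type*} [TopologicalSpace Ω] : CoeFun (U0 Ω) (fun _ => Ω → ℝ) :=
  ⟨U0.toFun⟩

/-- The map `T_φ : U₀(Ω) → U₀(Ω)`, `f ↦ f ∘ φ⁻¹`. -/
def U0.koopman {Ω : Type*} [TopologicalSpace Ω] (φ : Ω ≃ₜ Ω) (f : U0 Ω) : U0 Ω where
  toFun := fun x => f (φ.symm x)
  usc := f.usc.comp φ.symm.continuous
  vanish := by
    intro ε hε
    obtain ⟨K, hK, h⟩ := f.vanish ε hε
    refine ⟨φ '' K, hK.image φ.continuous, fun x hx => h _ fun hx' => hx ⟨_, hx', ?_⟩⟩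
    simp

/-- A `U₀(Ω)`-valued norm on a Banach module `Γ` over `C₀(Ω)`. Its values lie in `U₀(Ω)₊`, and the
norm of an element of `U₀(Ω)₊` is its supremum. A `U₀(Ω)`-normed module is a Banach module over
`C₀(Ω)` together with such a norm. -/
structure U0ValuedNorm (Ω : Type*) (𝕜 : Type*) (Γ : Type*) [TopologicalSpace Ω] [RCLike 𝕜]
    [NormedAddCommGroup Γ] [NormedSpace 𝕜 Γ] [SMul C₀(Ω, 𝕜) Γ] where
  toFun : Γ → U0 Ω
  nonneg : ∀ (s : Γ) (x : Ω), 0 ≤ toFun s x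
  norm_eq : ∀ s : Γ, ⨆ x, toFun s x = ‖s‖
  smul_eq : ∀ (f : C₀(Ω, 𝕜)) (s : Γ) (x : Ω), toFun (f • s) x = ‖f x‖ * toFun s x
  add_le : ∀ (s t : Γ) (x : Ω), toFun (s + t) x ≤ toFun s x + toFun t x

instance U0ValuedNorm.instCoeFun {Ω : Type*} {𝕜 : Type*} {Γ : Type*} [TopologicalSpace Ω]
    [RCLike 𝕜] [NormedAddCommGroup Γ] [NormedSpace 𝕜 Γ] [SMul C₀(Ω, 𝕜) Γ] :
    CoeFun (U0ValuedNorm Ω 𝕜 Γ) (fun _ => Γ → U0 Ω) :=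
  ⟨U0ValuedNorm.toFun⟩

/-! ### Koopman operators, `T_φ`-homomorphisms, supports -/

/-- The Koopman operator `T_φ : C₀(Ω) → C₀(Ω)`, `f ↦ f ∘ φ⁻¹`. -/
def koopman {Ω : Type*} [TopologicalSpace Ω] {𝕜 : Type*} [RCLike 𝕜] (φ : Ω ≃ₜ Ω)
    (f : C₀(Ω, 𝕜)) : C₀(Ω, 𝕜) :=
  f.comp φ.symm.toCocompactMap

/-- `T` is a `T_φ`-homomorphism: `T (f s) = T_φ f · T s`. -/
def IsKoopmanHom {Ω : Type*} [TopologicalSpace Ω] {𝕜 : Type*} [RCLike 𝕜] (φ : Ω ≃ₜ Ω)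
    {Γ Λ : Type*} [NormedAddCommGroup Γ] [NormedSpace 𝕜 Γ] [SMul C₀(Ω, 𝕜) Γ]
    [NormedAddCommGroup Λ] [NormedSpace 𝕜 Λ] [SMul C₀(Ω, 𝕜) Λ] (T : Γ →L[𝕜] Λ) : Prop :=
  ∀ (f : C₀(Ω, 𝕜)) (s : Γ), T (f • s) = koopman φ f • T s

/-- The support in `Ω` of an element of a Banach module over `C₀(Ω)`. -/
def moduleSupport (Ω : Type*) [TopologicalSpace Ω] (𝕜 : Type*) [RCLike 𝕜] {Γ : Type*}
    [NormedAddCommGroup Γ] [SMul C₀(Ω, 𝕜) Γ] (s : Γ) : Set Ω :=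
  {x | ∀ f : C₀(Ω, 𝕜), f x ≠ 0 → f • s ≠ 0}

/-! ### Topological Banach bundles -/

/-- A topological Banach bundle over `Ω`, presented through its family of fibers; the total space
is the disjoint union `Bundle.TotalSpace PUnit Fiber` of the fibers (the argument `PUnit` is a
dummy) with a topology that is part of the data. Surjectivity of the projection is automatic as
every fiber contains `0`. -/
structure BanachBundle (𝕜 : Type u) (Ω : Type v) [RCLike 𝕜] [TopologicalSpace Ω] where
  Fiber : Ω → Type w
  [normedAddCommGroup : ∀ x, NormedAddCommGroup (Fiber x)]
  [normedSpace : ∀ x, NormedSpace 𝕜 (Fiber x)]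
  [completeSpace : ∀ x, CompleteSpace (Fiber x)]
  [topology : TopologicalSpace (Bundle.TotalSpace PUnit.{1} Fiber)]
  continuous_proj : Continuous (fun v : Bundle.TotalSpace PUnit.{1} Fiber => v.proj)
  isOpenMap_proj : IsOpenMap (fun v : Bundle.TotalSpace PUnit.{1} Fiber => v.proj)
  /-- Addition is continuous on the fiber product, a subspace of the square of the total space. -/
  continuous_add : Continuous
    (fun p : {p : Bundle.TotalSpace PUnit.{1} Fiber × Bundle.TotalSpace PUnit.{1} Fiber //
        p.1.proj = p.2.proj} =>
      (⟨p.1.2.proj, (p.2 ▸ p.1.1.snd : Fiber p.1.2.proj) + p.1.2.snd⟩ :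
        Bundle.TotalSpace PUnit.{1} Fiber))
  continuous_smul : Continuous
    (fun p : 𝕜 × Bundle.TotalSpace PUnit.{1} Fiber =>
      (⟨p.2.proj, p.1 • p.2.snd⟩ : Bundle.TotalSpace PUnit.{1} Fiber))
  usc_norm : UpperSemicontinuous (fun v : Bundle.TotalSpace PUnit.{1} Fiber => ‖v.snd‖)
  tube : ∀ (x : Ω) (W : Set (Bundle.TotalSpace PUnit.{1} Fiber)), IsOpen W →
    (⟨x, 0⟩ : Bundle.TotalSpace PUnit.{1} Fiber) ∈ W →
    ∃ ε : ℝ, 0 < ε ∧ ∃ U : Set Ω, IsOpen U ∧ x ∈ U ∧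
      {v : Bundle.TotalSpace PUnit.{1} Fiber | v.proj ∈ U ∧ ‖v.snd‖ ≤ ε} ⊆ W

namespace BanachBundle

attribute [instance] BanachBundle.normedAddCommGroup BanachBundle.normedSpace
  BanachBundle.completeSpace BanachBundle.topology

section

variable {𝕜 : Type*} {Ω : Type*} [RCLike 𝕜] [TopologicalSpace Ω]

/-- The total space of a Banach bundle. -/
abbrev Total (E : BanachBundle 𝕜 Ω) := Bundle.TotalSpace PUnit.{1} E.Fiber

theorem continuous_add_sections (E : BanachBundle 𝕜 Ω) {X : Type*} [TopologicalSpace X]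
    {b : X → Ω} {s t : ∀ x, E.Fiber (b x)}
    (hs : Continuous fun x => (⟨b x, s x⟩ : E.Total))
    (ht : Continuous fun x => (⟨b x, t x⟩ : E.Total)) :
    Continuous fun x => (⟨b x, s x + t x⟩ : E.Total) :=
  E.continuous_add.comp (f := fun x => ⟨((⟨b x, s x⟩ : E.Total), (⟨b x, t x⟩ : E.Total)), rfl⟩)
    (Continuous.subtype_mk (hs.prodMk ht) fun _ => rfl)

theorem continuous_smul_sections (E : BanachBundle 𝕜 Ω) {X : Type*} [TopologicalSpace X]
    {b : X → Ω} {c : X → 𝕜} {s : ∀ x, E.Fiber (b x)} (hc : Continuous c)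
    (hs : Continuous fun x => (⟨b x, s x⟩ : E.Total)) :
    Continuous fun x => (⟨b x, c x • s x⟩ : E.Total) :=
  E.continuous_smul.comp (hc.prodMk hs)

theorem continuous_zero_section (E : BanachBundle 𝕜 Ω) :
    Continuous fun x => (⟨x, 0⟩ : E.Total) := by
  refine continuous_iff_continuousAt.2 fun x => ?_
  rw [ContinuousAt, tendsto_nhds]
  intro W hW hx
  obtain ⟨ε, hε, U, hU, hxU, h⟩ := E.tube x W hW hx
  filter_upwards [hU.mem_nhds hxU] with y hy
  exact h ⟨hy, by simpa using hε.le⟩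

/-- The submodule of all sections that are continuous and vanish at infinity. -/
def c0Sections (E : BanachBundle 𝕜 Ω) : Submodule 𝕜 (∀ x, E.Fiber x) where
  carrier := {s | Continuous (fun x => (⟨x, s x⟩ : E.Total)) ∧
    ∀ ε : ℝ, 0 < ε → ∃ K : Set Ω, IsCompact K ∧ ∀ x, x ∉ K → ‖s x‖ ≤ ε}
  add_mem' := by
    rintro s t ⟨hs, hs'⟩ ⟨ht, ht'⟩
    refine ⟨E.continuous_add_sections hs ht, fun ε hε => ?_⟩
    obtain ⟨K, hK, h⟩ := hs' (ε / 2) (half_pos hε)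
    obtain ⟨L, hL, h'⟩ := ht' (ε / 2) (half_pos hε)
    refine ⟨K ∪ L, hK.union hL, fun x hx => (norm_add_le _ _).trans ?_⟩
    have := h x fun hk => hx (Or.inl hk)
    have := h' x fun hk => hx (Or.inr hk)
    linarith
  zero_mem' := ⟨E.continuous_zero_section, fun ε hε =>
    ⟨∅, isCompact_empty, fun x _ => by simpa using hε.le⟩⟩
  smul_mem' := by
    rintro c s ⟨hs, hs'⟩
    refine ⟨E.continuous_smul_sections continuous_const hs, fun ε hε => ?_⟩
    obtain ⟨K, hK, h⟩ := hs' (ε / (‖c‖ + 1)) (by positivity)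
    refine ⟨K, hK, fun x hx => ?_⟩
    rw [Pi.smul_apply, norm_smul]
    have h1 := h x hx
    rw [le_div_iff₀ (by positivity)] at h1
    nlinarith [norm_nonneg (s x), norm_nonneg c]

/-- `Γ₀(E)`: the space of continuous sections of `E` vanishing at infinity. -/
def Gamma0 (E : BanachBundle 𝕜 Ω) := ↥E.c0Sections

namespace Gamma0

variable {E : BanachBundle 𝕜 Ω}

noncomputable instance : AddCommGroup E.Gamma0 := inferInstanceAs (AddCommGroup E.c0Sections)

noncomputable instance : Module 𝕜 E.Gamma0 := inferInstanceAs (Module 𝕜 E.c0Sections)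

instance : CoeFun E.Gamma0 (fun _ => ∀ x, E.Fiber x) := ⟨fun s => s.1⟩

@[ext] theorem ext {s t : E.Gamma0} (h : ∀ x, s x = t x) : s = t := Subtype.ext (funext h)

@[simp] theorem add_apply (s t : E.Gamma0) (x : Ω) : (s + t) x = s x + t x := rfl

@[simp] theorem neg_apply (s : E.Gamma0) (x : Ω) : (-s) x = -s x := rfl

@[simp] theorem sub_apply (s t : E.Gamma0) (x : Ω) : (s - t) x = s x - t x := rfl

@[simp] theorem zero_apply (x : Ω) : (0 : E.Gamma0) x = 0 := rfl

@[simp] theorem scalar_apply (c : 𝕜) (s : E.Gamma0) (x : Ω) : (c • s) x = c • s x := rfl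

theorem continuous (s : E.Gamma0) : Continuous fun x => (⟨x, s x⟩ : E.Total) := s.2.1

theorem vanish (s : E.Gamma0) :
    ∀ ε : ℝ, 0 < ε → ∃ K : Set Ω, IsCompact K ∧ ∀ x, x ∉ K → ‖s x‖ ≤ ε := s.2.2

/-- The function `|s| : x ↦ ‖s x‖` in `U₀(Ω)`. -/
def vnorm (s : E.Gamma0) : U0 Ω where
  toFun := fun x => ‖s x‖
  usc := E.usc_norm.comp s.continuous
  vanish := by simpa using s.vanish

theorem bddAbove (s : E.Gamma0) : BddAbove (Set.range fun x => ‖s x‖) := by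
  obtain ⟨K, hK, h⟩ := s.vanish 1 one_pos
  obtain ⟨M, hM⟩ := (s.vnorm.usc.upperSemicontinuousOn K).bddAbove_of_isCompact hK
  refine ⟨max M 1, ?_⟩
  rintro _ ⟨x, rfl⟩
  by_cases hx : x ∈ K
  · exact le_max_of_le_left (hM ⟨x, hx, rfl⟩)
  · exact le_max_of_le_right (h x hx)

/-- The norm on `Γ₀(E)` is the supremum norm. -/
noncomputable instance : Norm E.Gamma0 := ⟨fun s => ⨆ x, ‖s x‖⟩

theorem norm_def (s : E.Gamma0) : ‖s‖ = ⨆ x, ‖s x‖ := rfl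

theorem norm_apply_le (s : E.Gamma0) (x : Ω) : ‖s x‖ ≤ ‖s‖ := le_ciSup s.bddAbove x

theorem norm_le {s : E.Gamma0} {M : ℝ} (hM : 0 ≤ M) (h : ∀ x, ‖s x‖ ≤ M) : ‖s‖ ≤ M :=
  Real.iSup_le h hM

theorem norm_nonneg' (s : E.Gamma0) : 0 ≤ ‖s‖ := Real.iSup_nonneg fun _ => norm_nonneg _

noncomputable instance : NormedAddCommGroup E.Gamma0 :=
  AddGroupNorm.toNormedAddCommGroup
    { toFun := fun s => ‖s‖
      map_zero' := le_antisymm (norm_le le_rfl fun x => by simp) (norm_nonneg' _)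
      add_le' := fun s t => norm_le (add_nonneg s.norm_nonneg' t.norm_nonneg') fun x =>
        (norm_add_le _ _).trans (add_le_add (s.norm_apply_le x) (t.norm_apply_le x))
      neg' := fun s => by simp [norm_def]
      eq_zero_of_map_eq_zero' := fun s hs => by
        ext x
        have := s.norm_apply_le x
        rw [hs] at this
        simpa using this }

noncomputable instance : NormedSpace 𝕜 E.Gamma0 where
  norm_smul_le c s := norm_le (mul_nonneg (norm_nonneg c) s.norm_nonneg') fun x => by
    rw [scalar_apply, norm_smul]
    exact mul_le_mul_of_nonneg_left (s.norm_apply_le x) (norm_nonneg c)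

/-- The pointwise multiplication `(f s)(x) = f(x) s(x)` of `C₀(Ω)` on `Γ₀(E)`. -/
noncomputable instance : SMul C₀(Ω, 𝕜) E.Gamma0 where
  smul f s := ⟨fun x => f x • s x, E.continuous_smul_sections f.continuous s.continuous, by
    intro ε hε
    obtain ⟨K, hK, h⟩ := s.vanish (ε / (‖f‖ + 1)) (by positivity)
    refine ⟨K, hK, fun x hx => ?_⟩
    have h1 := h x hx
    rw [le_div_iff₀ (by positivity)] at h1
    have h2 : ‖f x‖ ≤ ‖f‖ := f.toBCF.norm_coe_le_norm x
    rw [norm_smul]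
    nlinarith [norm_nonneg (s x), norm_nonneg (f x)]⟩

@[simp] theorem smul_apply (f : C₀(Ω, 𝕜)) (s : E.Gamma0) (x : Ω) : (f • s) x = f x • s x := rfl

instance : CompleteSpace E.Gamma0 := by
  refine Metric.complete_of_cauchySeq_tendsto fun u hu => ?_
  have hpt : ∀ x, CauchySeq fun n => u n x := fun x => by
    rw [Metric.cauchySeq_iff] at hu ⊢
    intro ε hε
    obtain ⟨N, hN⟩ := hu ε hε
    refine ⟨N, fun m hm n hn => lt_of_le_of_lt ?_ (hN m hm n hn)⟩
    rw [dist_eq_norm, dist_eq_norm]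
    exact (u m - u n).norm_apply_le x
  choose l hl using fun x => cauchySeq_tendsto_of_complete (hpt x)
  have hunif : ∀ ε : ℝ, 0 < ε → ∃ N, ∀ n, N ≤ n → ∀ x, ‖l x - u n x‖ ≤ ε := by
    intro ε hε
    obtain ⟨N, hN⟩ := Metric.cauchySeq_iff.1 hu ε hε
    refine ⟨N, fun n hn x => ?_⟩
    refine le_of_tendsto ((hl x).sub_const (u n x)).norm ?_
    filter_upwards [Filter.eventually_ge_atTop N] with m hm
    have := hN m hm n hn
    rw [dist_eq_norm] at this
    exact ((u m - u n).norm_apply_le x).trans this.le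
  have hcont : Continuous fun x => (⟨x, l x⟩ : E.Total) := by
    refine continuous_iff_continuousAt.2 fun x => ?_
    rw [ContinuousAt, tendsto_nhds]
    intro W hW hx
    have hW' := hW.preimage E.continuous_add
    rw [isOpen_induced_iff] at hW'
    obtain ⟨O, hO, hOW⟩ := hW'
    have hadd : ∀ (y : Ω) (a b : E.Fiber y),
        ((⟨y, a⟩, ⟨y, b⟩) : E.Total × E.Total) ∈ O ↔ (⟨y, a + b⟩ : E.Total) ∈ W := by
      intro y a b
      exact Set.ext_iff.1 hOW ⟨((⟨y, a⟩, ⟨y, b⟩) : E.Total × E.Total), rfl⟩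
    have hx0 : (((⟨x, l x⟩ : E.Total), (⟨x, 0⟩ : E.Total)) : E.Total × E.Total) ∈ O := by
      rw [hadd]; simpa using hx
    obtain ⟨W1, W2, hW1, hW2, h1, h2, hsub⟩ := isOpen_prod_iff.1 hO _ _ hx0
    obtain ⟨ε, hε, U, hU, hxU, hUW⟩ := E.tube x W2 hW2 h2
    -- the values `u n x` converge to `l x` in the total space
    have hW1' := hW1.preimage E.continuous_add
    rw [isOpen_induced_iff] at hW1'
    obtain ⟨O', hO', hOW'⟩ := hW1'
    have hadd' : ∀ (y : Ω) (a b : E.Fiber y),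
        ((⟨y, a⟩, ⟨y, b⟩) : E.Total × E.Total) ∈ O' ↔ (⟨y, a + b⟩ : E.Total) ∈ W1 := by
      intro y a b
      exact Set.ext_iff.1 hOW' ⟨((⟨y, a⟩, ⟨y, b⟩) : E.Total × E.Total), rfl⟩
    have hx1 : (((⟨x, l x⟩ : E.Total), (⟨x, 0⟩ : E.Total)) : E.Total × E.Total) ∈ O' := by
      rw [hadd']; simpa using h1
    obtain ⟨V1, V2, hV1, hV2, k1, k2, ksub⟩ := isOpen_prod_iff.1 hO' _ _ hx1
    obtain ⟨δ, hδ, U', hU', hxU', hUW'⟩ := E.tube x V2 hV2 k2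
    obtain ⟨N, hN⟩ := hunif (min ε δ) (lt_min hε hδ)
    have hNx : (⟨x, u N x⟩ : E.Total) ∈ W1 := by
      have : (⟨x, l x + (u N x - l x)⟩ : E.Total) ∈ W1 := by
        rw [← hadd']
        refine ksub ⟨k1, hUW' ⟨hxU', ?_⟩⟩
        have := (hN N le_rfl x).trans (min_le_right _ _)
        rwa [norm_sub_rev] at this
      simpa using this
    filter_upwards [hU.mem_nhds hxU,
      (u N).continuous.continuousAt.preimage_mem_nhds (hW1.mem_nhds hNx)] with y hy hy'
    have : (⟨y, u N y + (l y - u N y)⟩ : E.Total) ∈ W := by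
      rw [← hadd]
      exact hsub ⟨hy', hUW ⟨hy, (hN N le_rfl y).trans (min_le_left _ _)⟩⟩
    simpa using this
  have hvan : ∀ ε : ℝ, 0 < ε → ∃ K : Set Ω, IsCompact K ∧ ∀ x, x ∉ K → ‖l x‖ ≤ ε := by
    intro ε hε
    obtain ⟨N, hN⟩ := hunif (ε / 2) (half_pos hε)
    obtain ⟨K, hK, h⟩ := (u N).vanish (ε / 2) (half_pos hε)
    refine ⟨K, hK, fun x hx => ?_⟩
    have h1 := h x hx
    have h2 := hN N le_rfl x
    calc ‖l x‖ = ‖(l x - u N x) + u N x‖ := by simp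
      _ ≤ ‖l x - u N x‖ + ‖u N x‖ := norm_add_le _ _
      _ ≤ ε := by linarith
  let L : E.Gamma0 := ⟨l, hcont, hvan⟩
  refine ⟨L, Metric.tendsto_atTop.2 fun ε hε => ?_⟩
  obtain ⟨N, hN⟩ := hunif (ε / 2) (half_pos hε)
  refine ⟨N, fun n hn => lt_of_le_of_lt ?_ (half_lt_self hε)⟩
  rw [dist_comm, dist_eq_norm]
  exact norm_le (s := L - u n) (half_pos hε).le fun x => hN n hn x

/-- `Γ₀(E)` is a Banach module over `C₀(Ω)`. -/
instance [LocallyCompactSpace Ω] [T2Space Ω] : IsBanachModule 𝕜 C₀(Ω, 𝕜) E.Gamma0 where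
  complete := inferInstance
  smul_add f s t := by ext x; simp
  add_smul f g s := by ext x; simp [_root_.add_smul]
  mul_smul f g s := by ext x; simp [smul_smul]
  scalar_smul c f s := by ext x; simp [smul_smul]
  smul_scalar c f s := by ext x; simp [smul_comm c (f x) (s x)]
  norm_smul_le f s := norm_le (mul_nonneg (norm_nonneg f) (norm_nonneg s)) fun x => by
    rw [smul_apply, norm_smul]
    exact mul_le_mul (f.toBCF.norm_coe_le_norm x) (s.norm_apply_le x) (norm_nonneg _)
      (norm_nonneg _)
  nondegenerate := by
    rw [eq_top_iff]
    intro s _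
    refine Metric.mem_closure_iff.2 fun ε hε => ?_
    obtain ⟨K, hK, h⟩ := s.vanish (ε / 2) (half_pos hε)
    obtain ⟨f, hf1, -, hfc, hf01⟩ := exists_continuous_one_zero_of_isCompact hK
      (isClosed_empty (X := Ω)) (Set.disjoint_empty K)
    let g : C₀(Ω, 𝕜) :=
      { toFun := fun x => (f x : 𝕜)
        continuous_toFun := RCLike.continuous_ofReal.comp f.continuous
        zero_at_infty' := by
          have : HasCompactSupport fun x => ((f x : ℝ) : 𝕜) :=
            hfc.comp_left (g := fun r : ℝ => (r : 𝕜)) RCLike.ofReal_zero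
          exact this.is_zero_at_infty }
    have hg : ∀ x, g x = (f x : 𝕜) := fun _ => rfl
    refine ⟨g • s, Submodule.subset_span ⟨(g, s), rfl⟩, lt_of_le_of_lt ?_ (half_lt_self hε)⟩
    rw [dist_eq_norm]
    refine norm_le (half_pos hε).le fun x => ?_
    rw [sub_apply, smul_apply, hg]
    by_cases hx : x ∈ K
    · have : f x = 1 := hf1 hx
      simpa [this] using (half_pos hε).le
    · have h1 : s x - (f x : 𝕜) • s x = ((1 - f x : ℝ) : 𝕜) • s x := by
        rw [RCLike.ofReal_sub, RCLike.ofReal_one, sub_smul, one_smul]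
      rw [h1, norm_smul, RCLike.norm_ofReal, abs_of_nonneg (by linarith [(hf01 x).2])]
      nlinarith [(hf01 x).1, h x hx, norm_nonneg (s x)]

variable (E) in
/-- The canonical `U₀(Ω)`-valued norm `|s|(x) = ‖s x‖` on `Γ₀(E)`. -/
noncomputable def valuedNorm : U0ValuedNorm Ω 𝕜 E.Gamma0 where
  toFun := vnorm
  nonneg s x := norm_nonneg (s x)
  norm_eq _ := rfl
  smul_eq f s x := norm_smul (f x) (s x)
  add_le s t x := norm_add_le (s x) (t x)

end Gamma0

/-! ### Morphisms of Banach bundles and weighted Koopman operators -/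

/-- A (bounded) Banach bundle morphism from `E` to `F` over `φ`: a family of bounded operators
`E_x → F_{φ(x)}` with uniformly bounded norms whose union is a continuous map of total spaces. -/
structure Morphism (φ : Ω → Ω) (E F : BanachBundle 𝕜 Ω) where
  fiberMap : ∀ x, E.Fiber x →L[𝕜] F.Fiber (φ x)
  continuous_total :
    Continuous (fun v : E.Total => (⟨φ v.proj, fiberMap v.proj v.snd⟩ : F.Total))
  bddAbove : BddAbove (Set.range fun x => ‖fiberMap x‖)

namespace Morphism

variable {E F : BanachBundle 𝕜 Ω}

/-- `‖Φ‖ = sup_x ‖Φ|_{E_x}‖`. -/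
noncomputable def norm {φ : Ω → Ω} (Φ : Morphism φ E F) : ℝ := ⨆ x, ‖Φ.fiberMap x‖

/-- `Φ` is isometric if it is so on each fiber. -/
def IsIsometric {φ : Ω → Ω} (Φ : Morphism φ E F) : Prop := ∀ x, Isometry (Φ.fiberMap x)

theorem total_cast {x y : Ω} (h : x = y) (w : F.Fiber x) :
    (⟨y, h ▸ w⟩ : F.Total) = ⟨x, w⟩ := by
  subst h; rfl

theorem norm_cast' {x y : Ω} (h : x = y) (w : F.Fiber x) :
    ‖(h ▸ w : F.Fiber y)‖ = ‖w‖ := by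
  subst h; rfl

theorem add_cast {x y : Ω} (h : x = y) (w w' : F.Fiber x) :
    (h ▸ (w + w') : F.Fiber y) = (h ▸ w) + (h ▸ w') := by
  subst h; rfl

theorem smul_cast {x y : Ω} (h : x = y) (c : 𝕜) (w : F.Fiber x) :
    (h ▸ (c • w) : F.Fiber y) = c • (h ▸ w : F.Fiber y) := by
  subst h; rfl

theorem norm_apply_le {φ : Ω → Ω} (Φ : Morphism φ E F) (x : Ω) (v : E.Fiber x) :
    ‖Φ.fiberMap x v‖ ≤ Φ.norm * ‖v‖ :=
  ((Φ.fiberMap x).le_opNorm v).trans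
    (mul_le_mul_of_nonneg_right (le_ciSup Φ.bddAbove x) (norm_nonneg v))

theorem norm_nonneg {φ : Ω → Ω} (Φ : Morphism φ E F) : 0 ≤ Φ.norm :=
  Real.iSup_nonneg fun _ => _root_.norm_nonneg _

/-- The section `Φ ∘ s ∘ φ⁻¹` of `F`; the cast identifies the fiber over `φ (φ⁻¹ x)` with the one
over `x`. -/
def mapSection {φ : Ω ≃ₜ Ω} (Φ : Morphism φ E F) (s : E.Gamma0) : F.Gamma0 :=
  ⟨fun x => φ.apply_symm_apply x ▸ Φ.fiberMap (φ.symm x) (s (φ.symm x)), by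
    have h : (fun x => (⟨x, φ.apply_symm_apply x ▸ Φ.fiberMap (φ.symm x) (s (φ.symm x))⟩ :
        F.Total)) = (fun v : E.Total => (⟨φ v.proj, Φ.fiberMap v.proj v.snd⟩ : F.Total)) ∘
          (fun x => (⟨x, s x⟩ : E.Total)) ∘ φ.symm := by
      funext x
      exact total_cast _ _
    rw [h]
    exact Φ.continuous_total.comp (s.continuous.comp φ.symm.continuous), by
    intro ε hε
    have hn := Φ.norm_nonneg
    obtain ⟨K, hK, h⟩ := s.vanish (ε / (Φ.norm + 1)) (by positivity)
    refine ⟨φ '' K, hK.image φ.continuous, fun x hx => ?_⟩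
    have h1 := h (φ.symm x) fun hk => hx ⟨_, hk, φ.apply_symm_apply x⟩
    rw [le_div_iff₀ (by positivity)] at h1
    rw [norm_cast']
    have h2 := Φ.norm_apply_le (φ.symm x) (s (φ.symm x))
    nlinarith [_root_.norm_nonneg (s (φ.symm x))]⟩

/-- The weighted Koopman operator `𝒯_Φ : Γ₀(E) → Γ₀(F)`, `s ↦ Φ ∘ s ∘ φ⁻¹`. -/
noncomputable def weightedKoopman {φ : Ω ≃ₜ Ω} (Φ : Morphism φ E F) :
    E.Gamma0 →L[𝕜] F.Gamma0 :=
  LinearMap.mkContinuous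
    { toFun := Φ.mapSection
      map_add' := fun s t => Gamma0.ext fun x => by
        simp only [mapSection, Gamma0.add_apply, map_add]
        exact add_cast _ _ _
      map_smul' := fun c s => Gamma0.ext fun x => by
        simp only [mapSection, Gamma0.scalar_apply, map_smul, RingHom.id_apply]
        exact smul_cast _ _ _ }
    Φ.norm (fun s => Gamma0.norm_le (mul_nonneg Φ.norm_nonneg (_root_.norm_nonneg s)) fun x => by
      refine (norm_cast' (φ.apply_symm_apply x) _).trans_le ((Φ.norm_apply_le _ _).trans ?_)
      exact mul_le_mul_of_nonneg_left (s.norm_apply_le _) Φ.norm_nonneg)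

end Morphism

end

end BanachBundle

/-! For a `U₀(Ω)`-normed module everything rests on the localization formula |s|(x) = inf {‖f s‖ :
f(x) = 1}. The bound ≤ holds because |s|(x) = |f s|(x) ≤ ‖f s‖. For the other bound, upper
semicontinuity makes {|s| < r} open, so a bump function supported there gives ‖f s‖ ≤ r
(`exists_smul_norm_le`).

The cycle is (a) ⇒ (c) ⇒ (d) ⇒ (b) ⇒ (a). If T is a `T_φ`-homomorphism and f(x) = 1, then |T s|(φ x)
= |T(f s)|(φ x) ≤ ‖T‖ ‖f s‖, and the infimum over f gives (c). A pointwise bound carries f s = 0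
over to T_φ f · T s = 0, which gives (b). Conversely, an operator respecting supports is local, and
by boundedness T(h s) vanishes at φ(x) as soon as h(x) = 0
(`apply_smul_eq_zero_of_moduleSupport_subset`). Replacing f by the constant f(x) near x shows that
T(f s) and T_φ f · T s both agree with f(x) T s at φ(x).

For bundles, (d) says that (T s)(φ x) depends only on s(x), boundedly and linearly, which defines Φ
on all vectors that are values of sections. The hard ingredient is that these are all vectors:
through every point of the total space passes a continuous section (`exists_section`). That is
proved by successive approximation. Openness of the projection gives local choices with small
discontinuity, measured by `DefectLE`; partitions of unity glue them, and a fiberwise uniform limit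
of sections with defect tending to 0 has defect 0, hence is continuous. Uniqueness, the norm and the
isometry statement follow by evaluating at sections through a given vector. -/

namespace BanachBundle

open Topology Filter

variable {𝕜 : Type*} {Ω : Type*} [RCLike 𝕜] [TopologicalSpace Ω]

/-! ### Neighborhoods in the total space of a Banach bundle -/

theorem exists_nhds_add_mem (E : BanachBundle 𝕜 Ω) {y : Ω} {u w : E.Fiber y} {O : Set E.Total}
    (hO : O ∈ 𝓝 (⟨y, u + w⟩ : E.Total)) :
    ∃ V ∈ 𝓝 (⟨y, u⟩ : E.Total), ∃ W ∈ 𝓝 (⟨y, w⟩ : E.Total), ∀ (z : Ω) (a b : E.Fiber z),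
      (⟨z, a⟩ : E.Total) ∈ V → (⟨z, b⟩ : E.Total) ∈ W → (⟨z, a + b⟩ : E.Total) ∈ O := by
  have h := E.continuous_add.continuousAt
    (x := ⟨((⟨y, u⟩, ⟨y, w⟩) : E.Total × E.Total), rfl⟩) hO
  rw [mem_map, nhds_subtype_eq_comap, mem_comap] at h
  obtain ⟨t, ht, hsub⟩ := h
  rw [nhds_prod_eq, mem_prod_iff] at ht
  obtain ⟨V, hV, W, hW, hVW⟩ := ht
  refine ⟨V, hV, W, hW, fun z a b ha hb => ?_⟩
  exact @hsub ⟨((⟨z, a⟩, ⟨z, b⟩) : E.Total × E.Total), rfl⟩ (hVW ⟨ha, hb⟩)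

theorem exists_nhds_smul_mem (E : BanachBundle 𝕜 Ω) {y : Ω} {c : 𝕜} {u : E.Fiber y}
    {O : Set E.Total} (hO : O ∈ 𝓝 (⟨y, c • u⟩ : E.Total)) :
    ∃ N ∈ 𝓝 c, ∃ V ∈ 𝓝 (⟨y, u⟩ : E.Total), ∀ (z : Ω) (d : 𝕜) (a : E.Fiber z),
      d ∈ N → (⟨z, a⟩ : E.Total) ∈ V → (⟨z, d • a⟩ : E.Total) ∈ O := by
  have h := E.continuous_smul.continuousAt (x := ((c, ⟨y, u⟩) : 𝕜 × E.Total)) hO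
  rw [mem_map, nhds_prod_eq, mem_prod_iff] at h
  obtain ⟨N, hN, V, hV, hVW⟩ := h
  exact ⟨N, hN, V, hV, fun z d a hd ha => @hVW (d, ⟨z, a⟩) ⟨hd, ha⟩⟩

theorem eventually_norm_lt (E : BanachBundle 𝕜 Ω) {y : Ω} {u : E.Fiber y} {r : ℝ}
    (hr : ‖u‖ < r) : ∀ᶠ b : E.Total in 𝓝 ⟨y, u⟩, ‖b.snd‖ < r :=
  E.usc_norm ⟨y, u⟩ r hr

/-- Subtraction is continuous and the norm is upper semicontinuous. With `u = w` this yields thin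
neighborhoods of a point: any two of their elements in a common fiber are close. -/
theorem exists_nhds_norm_sub_lt (E : BanachBundle 𝕜 Ω) {y : Ω} {u w : E.Fiber y} {r : ℝ}
    (hr : ‖u - w‖ < r) :
    ∃ V ∈ 𝓝 (⟨y, u⟩ : E.Total), ∃ W ∈ 𝓝 (⟨y, w⟩ : E.Total), ∀ (z : Ω) (a b : E.Fiber z),
      (⟨z, a⟩ : E.Total) ∈ V → (⟨z, b⟩ : E.Total) ∈ W → ‖a - b‖ < r := by
  have h0 : ‖u + (-1 : 𝕜) • w‖ < r := by rwa [neg_one_smul, ← sub_eq_add_neg]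
  obtain ⟨V, hV, W, hW, h⟩ := E.exists_nhds_add_mem (E.eventually_norm_lt h0)
  obtain ⟨N, hN, W', hW', h'⟩ := E.exists_nhds_smul_mem hW
  refine ⟨V, hV, W', hW', fun z a b ha hb => ?_⟩
  have := h z a _ ha (h' z _ b (mem_of_mem_nhds hN) hb)
  simpa [sub_eq_add_neg] using this

theorem eventually_exists_mem (E : BanachBundle 𝕜 Ω) {y : Ω} {u : E.Fiber y} {V : Set E.Total}
    (hV : V ∈ 𝓝 (⟨y, u⟩ : E.Total)) : ∀ᶠ z in 𝓝 y, ∃ a : E.Fiber z, (⟨z, a⟩ : E.Total) ∈ V := by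
  filter_upwards [E.isOpenMap_proj.image_mem_nhds hV] with z hz
  obtain ⟨⟨z', a⟩, ha, rfl⟩ := hz
  exact ⟨a, ha⟩

theorem tendsto_proj (E : BanachBundle 𝕜 Ω) (y : Ω) (u : E.Fiber y) :
    Tendsto (fun b : E.Total => b.proj) (𝓝 ⟨y, u⟩) (𝓝 y) :=
  E.continuous_proj.tendsto (⟨y, u⟩ : E.Total)

/-! ### Calculus of the discontinuity defect of a section -/

/-- The (not necessarily continuous) section `f` fails to be continuous at `y` by at most `ε`. -/
def DefectLE (E : BanachBundle 𝕜 Ω) (f : ∀ x, E.Fiber x) (y : Ω) (ε : ℝ) : Prop :=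
  ∀ δ, ε < δ → ∀ᶠ b : E.Total in 𝓝 ⟨y, f y⟩, ‖b.snd - f b.proj‖ < δ

namespace DefectLE

variable {E : BanachBundle 𝕜 Ω} {f g : ∀ x, E.Fiber x} {y : Ω} {ε η : ℝ}

theorem mono (hf : E.DefectLE f y ε) (h : ε ≤ η) : E.DefectLE f y η :=
  fun δ hδ => hf δ (h.trans_lt hδ)

theorem of_mem_nhds {V : Set E.Total} (hV : V ∈ 𝓝 (⟨y, f y⟩ : E.Total))
    (h : ∀ (z : Ω) (b : E.Fiber z), (⟨z, b⟩ : E.Total) ∈ V → ‖b - f z‖ ≤ ε) :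
    E.DefectLE f y ε := by
  intro δ hδ
  filter_upwards [hV] with b hb
  exact (h b.proj b.snd hb).trans_lt hδ

/-- Upper semicontinuity keeps nearby `b` of norm below `δ - η`; the triangle inequality with `‖f‖ ≤
η` then costs `η` a second time. -/
theorem of_norm_le (h : ∀ᶠ z in 𝓝 y, ‖f z‖ ≤ η) : E.DefectLE f y (2 * η) := by
  intro δ hδ
  have h1 : ‖f y‖ < δ - η := by linarith [h.self_of_nhds]
  filter_upwards [E.eventually_norm_lt h1, (E.tendsto_proj y (f y)).eventually h] with b hb hb'
  linarith [norm_sub_le b.snd (f b.proj)]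

theorem add (hf : E.DefectLE f y ε) (hg : E.DefectLE g y η) :
    E.DefectLE (fun z => f z + g z) y (ε + η) := by
  intro δ hδ
  set t := (δ - (ε + η)) / 3 with ht
  have ht0 : 0 < t := by rw [ht]; linarith
  have hA := hf (ε + t) (by linarith)
  have hB := hg (η + t) (by linarith)
  obtain ⟨V₀, hV₀, O, hO, hVO⟩ := E.exists_nhds_norm_sub_lt (u := f y + g y) (w := f y + g y)
    (r := t) (by simpa using ht0)
  obtain ⟨V, hV, W, hW, hVW⟩ := E.exists_nhds_add_mem hO
  -- A point `b` near `f y + g y` need not come split into summands. Openness of the projection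
  -- supplies `a` near `f y` and `a'` near `g y` in the fiber of `b`, and `b` and `a + a'` lie in
  -- one thin neighborhood of `f y + g y`.
  filter_upwards [hV₀,
    (E.tendsto_proj y _).eventually (E.eventually_exists_mem (inter_mem hA hV)),
    (E.tendsto_proj y _).eventually (E.eventually_exists_mem (inter_mem hB hW))]
    with b hb ⟨a, ha1, ha2⟩ ⟨a', ha1', ha2'⟩
  have h1 := hVO _ b.snd _ hb (hVW _ a a' ha2 ha2')
  have h2 : ‖a - f b.proj‖ < ε + t := ha1
  have h3 : ‖a' - g b.proj‖ < η + t := ha1'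
  have h4 : b.snd - (f b.proj + g b.proj)
      = (b.snd - (a + a')) + (a - f b.proj) + (a' - g b.proj) := by abel
  rw [h4]
  have := norm_add₃_le (a := b.snd - (a + a')) (b := a - f b.proj) (c := a' - g b.proj)
  have h5 : 3 * t = δ - (ε + η) := by rw [ht]; ring
  linarith

theorem smul {c : Ω → 𝕜} (hc : ContinuousAt c y) (hf : E.DefectLE f y ε) :
    E.DefectLE (fun z => c z • f z) y (‖c y‖ * ε) := by
  intro δ hδ
  -- The final estimate is this expression in `t`; its value at 0 is `‖c y‖ * ε < δ`, so some small
  -- `t > 0` works.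
  have hcont : ContinuousAt (fun t : ℝ => t + (‖c y‖ + t) * (ε + t)) 0 := by fun_prop
  have hev : ∀ᶠ t in 𝓝[>] (0 : ℝ), t + (‖c y‖ + t) * (ε + t) < δ :=
    (hcont.eventually_lt_const (by simpa using hδ)).filter_mono nhdsWithin_le_nhds
  obtain ⟨t, ht, ht0⟩ := (hev.and self_mem_nhdsWithin).exists
  have ht0 : 0 < t := ht0
  have hA := hf (ε + t) (by linarith)
  obtain ⟨V₀, hV₀, O, hO, hVO⟩ := E.exists_nhds_norm_sub_lt (u := c y • f y) (w := c y • f y)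
    (r := t) (by simpa using ht0)
  obtain ⟨N, hN, V, hV, hNV⟩ := E.exists_nhds_smul_mem hO
  have hcn : ∀ᶠ z in 𝓝 y, ‖c z‖ < ‖c y‖ + t :=
    hc.norm.eventually_lt_const (by linarith)
  filter_upwards [hV₀,
    (E.tendsto_proj y _).eventually (E.eventually_exists_mem (inter_mem hA hV)),
    (E.tendsto_proj y _).eventually hcn, (E.tendsto_proj y _).eventually (hc hN)]
    with b hb ⟨a, ha1, ha2⟩ hb2 hb3
  have h1 := hVO _ b.snd _ hb (hNV _ _ a hb3 ha2)
  have h2 : ‖a - f b.proj‖ < ε + t := ha1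
  have h4 : b.snd - c b.proj • f b.proj
      = (b.snd - c b.proj • a) + c b.proj • (a - f b.proj) := by rw [smul_sub]; abel
  have h5 : ‖c b.proj • (a - f b.proj)‖ ≤ (‖c y‖ + t) * (ε + t) := by
    rw [norm_smul]
    exact mul_le_mul hb2.le h2.le (norm_nonneg _) (by positivity)
  have h6 : ‖b.snd - c b.proj • f b.proj‖ < δ := by
    rw [h4]
    linarith [norm_add_le (b.snd - c b.proj • a) (c b.proj • (a - f b.proj))]
  exact h6

/-- Off the support of `c` the product vanishes on a neighborhood, so nothing about `f` is needed
there. This lets local sections be glued by a partition of unity. -/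
theorem smul_of_tsupport {c : C(Ω, ℝ)} (h0 : 0 ≤ c y)
    (hf : y ∈ tsupport c → E.DefectLE f y ε) :
    E.DefectLE (fun z => (c z : 𝕜) • f z) y (c y * ε) := by
  by_cases hy : y ∈ tsupport c
  · have := (hf hy).smul (c := fun z => (c z : 𝕜))
      (RCLike.continuous_ofReal.comp c.continuous).continuousAt
    simpa [abs_of_nonneg h0] using this
  · have h1 : c y = 0 := image_eq_zero_of_notMem_tsupport hy
    have h2 := of_norm_le (E := E) (f := fun z => (c z : 𝕜) • f z) (y := y) (η := 0) (by
      filter_upwards [(isClosed_tsupport c).isOpen_compl.mem_nhds hy] with z hz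
      simp [image_eq_zero_of_notMem_tsupport hz])
    simpa [h1] using h2

theorem sum {ι : Type*} (s : Finset ι) {f : ι → ∀ x, E.Fiber x} {ε : ι → ℝ}
    (h : ∀ i ∈ s, E.DefectLE (f i) y (ε i)) :
    E.DefectLE (fun z => ∑ i ∈ s, f i z) y (∑ i ∈ s, ε i) := by
  classical
  induction s using Finset.induction_on with
  | empty =>
    simpa using of_norm_le (E := E) (f := fun _ => 0) (y := y) (η := 0) (by simp)
  | insert i s hi ih =>
    simp only [Finset.sum_insert hi]
    exact (h i (by simp)).add (ih fun j hj => h j (by simp [hj]))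

/-- Over `z` near `y` choose `a` near `f y` in the total space. Zero defect makes `f z - a` small,
hence in a tube around the zero section, so `f z = a + (f z - a)` is near `f y`. -/
theorem continuous (h : ∀ y, E.DefectLE f y 0) :
    Continuous fun x => (⟨x, f x⟩ : E.Total) := by
  refine continuous_iff_continuousAt.2 fun y W hW => ?_
  obtain ⟨V, hV, V', hV', hVV⟩ := E.exists_nhds_add_mem (u := f y) (w := 0) (O := W)
    (by simpa using hW)
  obtain ⟨W', hW'V, hW', hyW'⟩ := mem_nhds_iff.1 hV'
  obtain ⟨ε, hε, U, hU, hyU, hUW⟩ := E.tube y W' hW' hyW'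
  have hUy := hU.mem_nhds hyU
  rw [mem_map]
  filter_upwards [hUy, E.eventually_exists_mem (inter_mem hV (h y ε hε))] with z hz ⟨a, ha, ha'⟩
  have ha' : ‖a - f z‖ < ε := ha'
  have := hVV z a (f z - a) ha (hW'V (hUW ⟨hz, by rw [norm_sub_rev]; exact ha'.le⟩))
  simpa using this

end DefectLE

/-! ### Continuous sections through prescribed points -/

/-- Over a suitable open set containing `x` one can choose values close to `f`, through `f x`, with
arbitrarily small defect. -/
theorem exists_local_section (E : BanachBundle 𝕜 Ω) {y : Ω} (v : E.Fiber y) {ε : ℝ} (hε : 0 < ε)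
    {O : Set E.Total} (hO : O ∈ 𝓝 (⟨y, v⟩ : E.Total)) :
    ∃ U : Set Ω, IsOpen U ∧ y ∈ U ∧ ∃ g : ∀ x, E.Fiber x, g y = v ∧
      ∀ z ∈ U, (⟨z, g z⟩ : E.Total) ∈ O ∧ E.DefectLE g z ε := by
  classical
  obtain ⟨V₁, hV₁, V₂, hV₂, hthin⟩ := E.exists_nhds_norm_sub_lt (u := v) (w := v) (r := ε)
    (by simpa using hε)
  obtain ⟨V, hVsub, hV, hvV⟩ := mem_nhds_iff.1 (inter_mem hO (inter_mem hV₁ hV₂))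
  -- `V` is a thin open neighborhood of `v`. Any choice of `g z` in `V` over the open image of `V`
  -- has defect at most `ε`, since `V` is also a neighborhood of each such `g z`.
  have hex : ∀ z, ∃ a : E.Fiber z, ((∃ b : E.Fiber z, (⟨z, b⟩ : E.Total) ∈ V) →
      (⟨z, a⟩ : E.Total) ∈ V) ∧ (∀ h : y = z, a = h ▸ v) := by
    intro z
    by_cases h : y = z
    · subst h
      exact ⟨v, fun _ => hvV, fun _ => rfl⟩
    · by_cases h' : ∃ b : E.Fiber z, (⟨z, b⟩ : E.Total) ∈ V
      · exact ⟨h'.choose, fun _ => h'.choose_spec, fun k => (h k).elim⟩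
      · exact ⟨0, fun k => (h' k).elim, fun k => (h k).elim⟩
  choose g hg hgy using hex
  refine ⟨(fun v : E.Total => v.proj) '' V, E.isOpenMap_proj V hV, ⟨_, hvV, rfl⟩, g, hgy y rfl, ?_⟩
  rintro _ ⟨⟨z, b⟩, hb, rfl⟩
  have hgz := hg z ⟨b, hb⟩
  exact ⟨(hVsub hgz).1, .of_mem_nhds (hV.mem_nhds hgz) fun w a ha =>
    (hthin w a (g w) (hVsub ha).2.1 (hVsub (hg w ⟨a, ha⟩)).2.2).le⟩

/-- Local sections of defect `η` through the values of `f` are averaged by a partition of unity.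
Defect and distance to `f` are convex under averaging, so both bounds survive. -/
theorem exists_refinement [LocallyCompactSpace Ω] [T2Space Ω] (E : BanachBundle 𝕜 Ω) {K : Set Ω}
    (hK : IsCompact K) {x : Ω} (hx : x ∈ K) {f : ∀ x, E.Fiber x} {ε η : ℝ} (hε : 0 < ε)
    (hη : 0 < η) (hf : ∀ y ∈ K, E.DefectLE f y ε) :
    ∃ g : ∀ x, E.Fiber x, g x = f x ∧ (∀ y ∈ K, E.DefectLE g y η) ∧
      ∀ y ∈ K, ‖g y - f y‖ ≤ 2 * ε := by
  classical
  have hex : ∀ y : K, ∃ U : Set Ω, IsOpen U ∧ y.1 ∈ U ∧ ∃ g : ∀ x, E.Fiber x,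
      (x ∈ U → g x = f x) ∧ ∀ z ∈ U, ‖g z - f z‖ ≤ 2 * ε ∧ E.DefectLE g z η := by
    rintro ⟨y, hy⟩
    -- Defect `ε` controls only tolerances strictly above `ε`; `2 * ε` is a convenient one.
    obtain ⟨U, hU, hyU, g, hgy, hg⟩ := E.exists_local_section (f y) hη (hf y hy (2 * ε)
      (by linarith))
    by_cases hxy : y = x
    · subst hxy
      exact ⟨U, hU, hyU, g, fun _ => hgy, fun z hz => ⟨(hg z hz).1.le, (hg z hz).2⟩⟩
    -- Removing `x` from these sets ensures that only pieces with the exact value `f x` contribute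
    -- at `x`.
    · exact ⟨U ∩ {x}ᶜ, hU.inter isOpen_compl_singleton, ⟨hyU, hxy⟩, g,
        fun h => (h.2 rfl).elim, fun z hz => ⟨(hg z hz.1).1.le, (hg z hz.1).2⟩⟩
  choose U hU hyU g hgx hg using hex
  obtain ⟨t, ht⟩ := hK.elim_finite_subcover U hU fun y hy => Set.mem_iUnion.2 ⟨⟨y, hy⟩, hyU _⟩
  obtain ⟨c, hcU, hc1, hc01, -⟩ := exists_continuous_sum_one_of_isOpen_isCompact
    (s := fun i : Fin t.card => U (t.equivFin.symm i)) (fun i => hU _) hK (by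
      intro y hy
      obtain ⟨i, hi, hy'⟩ := Set.mem_iUnion₂.1 (ht hy)
      exact Set.mem_iUnion.2 ⟨t.equivFin ⟨i, hi⟩, by simpa using hy'⟩)
  have hsum : ∀ y ∈ K, ∑ i, c i y = 1 := fun y hy => by simpa using hc1 hy
  have hsum' : ∀ y ∈ K, ∑ i, (c i y : 𝕜) = 1 := fun y hy => by
    exact_mod_cast congrArg (RCLike.ofReal (K := 𝕜)) (hsum y hy)
  refine ⟨fun z => ∑ i, (c i z : 𝕜) • g (t.equivFin.symm i) z, ?_, fun y hy => ?_, fun y hy => ?_⟩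
  · rw [← one_smul 𝕜 (f x), ← hsum' x hx, Finset.sum_smul]
    refine Finset.sum_congr rfl fun i _ => ?_
    by_cases h : x ∈ tsupport (c i)
    · rw [hgx _ (hcU i h)]
    · simp [image_eq_zero_of_notMem_tsupport h]
  · have := DefectLE.sum (E := E) (y := y) Finset.univ
      (f := fun i z => (c i z : 𝕜) • g (t.equivFin.symm i) z) (ε := fun i => c i y * η)
      fun i _ => DefectLE.smul_of_tsupport (hc01 i y).1 fun h => (hg _ y (hcU i h)).2
    rwa [← Finset.sum_mul, hsum y hy, one_mul] at this
  · rw [← one_smul 𝕜 (f y), ← hsum' y hy, Finset.sum_smul, ← Finset.sum_sub_distrib]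
    refine (norm_sum_le _ _).trans ?_
    rw [← one_mul (2 * ε), ← hsum y hy, Finset.sum_mul]
    refine Finset.sum_le_sum fun i _ => ?_
    rw [← smul_sub, norm_smul, RCLike.norm_ofReal, abs_of_nonneg (hc01 i y).1]
    by_cases h : y ∈ tsupport (c i)
    · exact mul_le_mul_of_nonneg_left (hg _ y (hcU i h)).1 (hc01 i y).1
    · simp [image_eq_zero_of_notMem_tsupport h]

theorem exists_bump [LocallyCompactSpace Ω] [T2Space Ω] {x : Ω} {U : Set Ω} (hU : IsOpen U)
    (hx : x ∈ U) : ∃ c : C(Ω, ℝ), c x = 1 ∧ tsupport c ⊆ U ∧ HasCompactSupport c ∧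
      ∀ y, c y ∈ Set.Icc (0 : ℝ) 1 := by
  obtain ⟨K, hK, hxK, hKU⟩ := exists_compact_subset hU hx
  obtain ⟨c, h1, h2, h3, h4⟩ := exists_continuous_one_zero_of_isCompact
    (isCompact_singleton (x := x)) isOpen_interior.isClosed_compl
    (Set.disjoint_left.2 fun y hy hy' => hy' (by rw [Set.mem_singleton_iff.1 hy]; exact hxK))
  refine ⟨c, h1 rfl, ?_, h3, h4⟩
  refine (closure_minimal (fun y hy => ?_) hK.isClosed).trans hKU
  by_contra hyK
  exact hy (h2 fun h => hyK (interior_subset h))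

/-- Banach bundles over locally compact spaces have enough continuous sections. -/
theorem exists_section [LocallyCompactSpace Ω] [T2Space Ω] (E : BanachBundle 𝕜 Ω) {x : Ω}
    (v : E.Fiber x) : ∃ s : E.Gamma0, s x = v := by
  obtain ⟨U, hU, hxU, g₀, hg₀x, hg₀⟩ := E.exists_local_section v one_pos univ_mem
  obtain ⟨K, hK, hxK, hKU⟩ := exists_compact_subset hU hxU
  have hstep : ∀ (n : ℕ) (f : {f : ∀ x, E.Fiber x // f x = v ∧
      ∀ y ∈ K, E.DefectLE f y ((1 / 2) ^ n)}), ∃ g : ∀ x, E.Fiber x, (g x = v ∧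
      ∀ y ∈ K, E.DefectLE g y ((1 / 2) ^ (n + 1))) ∧
      ∀ y ∈ K, ‖g y - f.1 y‖ ≤ 2 * (1 / 2) ^ n := by
    rintro n ⟨f, hfx, hf⟩
    obtain ⟨g, h1, h2, h3⟩ := E.exists_refinement hK (interior_subset hxK)
      (pow_pos one_half_pos n) (pow_pos one_half_pos (n + 1)) hf
    exact ⟨g, ⟨h1.trans hfx, h2⟩, h3⟩
  choose G hG hGd using hstep
  let F : ∀ n : ℕ, {f : ∀ x, E.Fiber x // f x = v ∧ ∀ y ∈ K, E.DefectLE f y ((1 / 2) ^ n)} :=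
    fun n => Nat.rec ⟨g₀, hg₀x, fun y hy => by simpa using (hg₀ y (hKU hy)).2⟩
      (fun n f => ⟨G n f, hG n f⟩) n
  have hF : ∀ n, ∀ y ∈ K, ‖(F (n + 1)).1 y - (F n).1 y‖ ≤ 2 * (1 / 2) ^ n :=
    fun n => hGd n (F n)
  -- Multiplying by a cutoff makes the estimates on `K` global and the limit compactly supported,
  -- while `c x = 1` keeps the value `v`.
  obtain ⟨c, hcx, hcK, -, hc01⟩ := exists_bump isOpen_interior hxK
  have hcK' : ∀ y, y ∉ K → c y = 0 := fun y hy =>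
    image_eq_zero_of_notMem_tsupport fun h => hy (interior_subset (hcK h))
  let h : ℕ → ∀ y, E.Fiber y := fun n y => (c y : 𝕜) • (F n).1 y
  have hdist : ∀ y n, dist (h n y) (h (n + 1) y) ≤ 2 * (1 / 2) ^ n := by
    intro y n
    rw [dist_comm, dist_eq_norm, ← smul_sub, norm_smul, RCLike.norm_ofReal,
      abs_of_nonneg (hc01 y).1]
    by_cases hy : y ∈ K
    · exact (mul_le_of_le_one_left (norm_nonneg _) (hc01 y).2).trans (hF n y hy)
    · rw [hcK' y hy, zero_mul]; positivity
  choose l hl using fun y => cauchySeq_tendsto_of_complete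
    (cauchySeq_of_le_geometric _ _ one_half_lt_one (hdist y))
  have hdl : ∀ y n, ‖l y - h n y‖ ≤ 4 * (1 / 2) ^ n := by
    intro y n
    have := dist_le_of_le_geometric_of_tendsto _ _ one_half_lt_one (hdist y) (hl y) n
    rw [dist_comm, dist_eq_norm] at this
    refine this.trans (le_of_eq ?_)
    ring
  have hh : ∀ n y, E.DefectLE (h n) y ((1 / 2) ^ n) := fun n y =>
    (DefectLE.smul_of_tsupport (hc01 y).1 fun hy =>
      (F n).2.2 y (interior_subset (hcK hy))).mono
      (mul_le_of_le_one_left (by positivity) (hc01 y).2)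
  have hl0 : ∀ y, E.DefectLE l y 0 := by
    intro y δ hδ
    -- The 9 is 1 + 2 · 4: defect `(1 / 2) ^ n` of `h n`, plus twice the bound `4 * (1 / 2) ^ n` on
    -- `l - h n`.
    obtain ⟨n, hn⟩ := exists_pow_lt_of_lt_one (show 0 < δ / 9 by positivity)
      (one_half_lt_one (α := ℝ))
    have h1 := (hh n y).add (DefectLE.of_norm_le (f := fun z => l z - h n z)
      (Eventually.of_forall fun z => hdl z n))
    simp only [add_sub_cancel] at h1
    exact h1 δ (by linarith)
  refine ⟨⟨l, DefectLE.continuous hl0, fun ε hε => ⟨K, hK, fun y hy => ?_⟩⟩, ?_⟩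
  · have : l y = 0 := tendsto_nhds_unique (hl y) (by simp [h, hcK' y hy])
    simpa [this] using hε.le
  · refine tendsto_nhds_unique (hl x) ?_
    simp [h, hcx, (F _).2.1]

end BanachBundle

/-! ### Bump functions, Koopman operators and module arithmetic -/

theorem exists_c0_bump (𝕜 : Type*) [RCLike 𝕜] {Ω : Type*} [TopologicalSpace Ω]
    [LocallyCompactSpace Ω] [T2Space Ω] {x : Ω} {U : Set Ω} (hU : IsOpen U) (hx : x ∈ U) :
    ∃ f : C₀(Ω, 𝕜), (∃ V, IsOpen V ∧ x ∈ V ∧ ∀ y ∈ V, f y = 1) ∧ (∀ y, y ∉ U → f y = 0) ∧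
      ∀ y, ‖f y‖ ≤ 1 := by
  obtain ⟨K, hK, hxK, hKU⟩ := exists_compact_subset hU hx
  obtain ⟨f, h1, h0, hfc, hf01⟩ := exists_continuous_one_zero_of_isCompact hK hU.isClosed_compl
    (Set.disjoint_left.2 fun y hy hy' => hy' (hKU hy))
  refine ⟨{ toFun := fun y => (f y : 𝕜)
            continuous_toFun := RCLike.continuous_ofReal.comp f.continuous
            zero_at_infty' := ?_ }, ⟨interior K, isOpen_interior, hxK, fun y hy => ?_⟩,
    fun y hy => ?_, fun y => ?_⟩
  · have : HasCompactSupport fun y => ((f y : ℝ) : 𝕜) :=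
      hfc.comp_left (g := fun r : ℝ => (r : 𝕜)) RCLike.ofReal_zero
    exact this.is_zero_at_infty
  · have : f y = 1 := h1 (interior_subset hy)
    change ((f y : ℝ) : 𝕜) = 1
    rw [this, RCLike.ofReal_one]
  · have : f y = 0 := h0 hy
    change ((f y : ℝ) : 𝕜) = 0
    rw [this, RCLike.ofReal_zero]
  · change ‖((f y : ℝ) : 𝕜)‖ ≤ 1
    rw [RCLike.norm_ofReal, abs_of_nonneg (hf01 y).1]
    exact (hf01 y).2

theorem koopman_apply_apply {Ω : Type*} [TopologicalSpace Ω] {𝕜 : Type*} [RCLike 𝕜] (φ : Ω ≃ₜ Ω)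
    (f : C₀(Ω, 𝕜)) (x : Ω) : koopman φ f (φ x) = f x :=
  congrArg f (φ.symm_apply_apply x)

theorem U0.koopman_apply_apply {Ω : Type*} [TopologicalSpace Ω] (φ : Ω ≃ₜ Ω) (f : U0 Ω) (x : Ω) :
    f.koopman φ (φ x) = f x :=
  congrArg f.toFun (φ.symm_apply_apply x)

theorem U0.bddAbove {Ω : Type*} [TopologicalSpace Ω] (f : U0 Ω) : BddAbove (Set.range f.toFun) := by
  obtain ⟨K, hK, h⟩ := f.vanish 1 one_pos
  obtain ⟨M, hM⟩ := (f.usc.upperSemicontinuousOn K).bddAbove_of_isCompact hK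
  refine ⟨max M 1, ?_⟩
  rintro _ ⟨x, rfl⟩
  by_cases hx : x ∈ K
  · exact le_max_of_le_left (hM ⟨x, hx, rfl⟩)
  · exact le_max_of_le_right ((le_abs_self _).trans (h x hx))

namespace IsBanachModule

theorem zero_smul (𝕜 : Type*) {A Γ : Type*} [RCLike 𝕜] [NonUnitalNormedCommRing A]
    [NormedSpace 𝕜 A] [NormedAddCommGroup Γ] [NormedSpace 𝕜 Γ] [SMul A Γ] [IsBanachModule 𝕜 A Γ]
    (s : Γ) : (0 : A) • s = 0 := by
  simpa using add_smul 𝕜 (0 : A) 0 s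

theorem sub_smul (𝕜 : Type*) {A Γ : Type*} [RCLike 𝕜] [NonUnitalNormedCommRing A]
    [NormedSpace 𝕜 A] [NormedAddCommGroup Γ] [NormedSpace 𝕜 Γ] [SMul A Γ] [IsBanachModule 𝕜 A Γ]
    (f g : A) (s : Γ) : (f - g) • s = f • s - g • s := by
  rw [eq_sub_iff_add_eq, ← add_smul 𝕜, sub_add_cancel]

theorem smul_sub (𝕜 : Type*) {A Γ : Type*} [RCLike 𝕜] [NonUnitalNormedCommRing A]
    [NormedSpace 𝕜 A] [NormedAddCommGroup Γ] [NormedSpace 𝕜 Γ] [SMul A Γ] [IsBanachModule 𝕜 A Γ]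
    (f : A) (s t : Γ) : f • (s - t) = f • s - f • t := by
  rw [eq_sub_iff_add_eq, ← smul_add 𝕜, sub_add_cancel]

end IsBanachModule

/-! ### Locality in `U₀(Ω)`-normed modules and the equivalence of (a)–(d) -/

section

open Topology Filter

variable {𝕜 : Type*} [RCLike 𝕜] {Ω : Type*} [TopologicalSpace Ω]
variable {Γ Λ : Type*}
  [NormedAddCommGroup Γ] [NormedSpace 𝕜 Γ] [SMul C₀(Ω, 𝕜) Γ]
  [NormedAddCommGroup Λ] [NormedSpace 𝕜 Λ] [SMul C₀(Ω, 𝕜) Λ]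

namespace U0ValuedNorm

theorem le_norm (N : U0ValuedNorm Ω 𝕜 Γ) (s : Γ) (x : Ω) : N s x ≤ ‖s‖ :=
  (le_ciSup (N s).bddAbove x).trans_eq (N.norm_eq s)

theorem norm_le (N : U0ValuedNorm Ω 𝕜 Γ) {s : Γ} {r : ℝ} (hr : 0 ≤ r) (h : ∀ x, N s x ≤ r) :
    ‖s‖ ≤ r :=
  (N.norm_eq s).symm.trans_le (Real.iSup_le h hr)

theorem apply_zero (N : U0ValuedNorm Ω 𝕜 Γ) (x : Ω) : N 0 x = 0 :=
  le_antisymm ((N.le_norm 0 x).trans_eq norm_zero) (N.nonneg 0 x)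

theorem eq_zero (N : U0ValuedNorm Ω 𝕜 Γ) {s : Γ} (h : ∀ x, N s x = 0) : s = 0 :=
  norm_le_zero_iff.1 (N.norm_le le_rfl fun x => (h x).le)

theorem apply_eq_zero_of_notMem_moduleSupport (N : U0ValuedNorm Ω 𝕜 Γ) {s : Γ} {x : Ω}
    (hx : x ∉ moduleSupport Ω 𝕜 s) : N s x = 0 := by
  simp only [moduleSupport, Set.mem_ofPred_eq, not_forall, not_not] at hx
  obtain ⟨f, hfx, hf⟩ := hx
  have := N.smul_eq f s x
  rw [hf, N.apply_zero, eq_comm, mul_eq_zero, norm_eq_zero] at this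
  exact this.resolve_left hfx

variable [LocallyCompactSpace Ω] [T2Space Ω]

theorem exists_smul_norm_le (N : U0ValuedNorm Ω 𝕜 Γ) {s : Γ} {x : Ω} {r : ℝ} (hr : N s x < r) :
    ∃ f : C₀(Ω, 𝕜), f x = 1 ∧ ‖f • s‖ ≤ r := by
  obtain ⟨f, ⟨V, -, hxV, hV⟩, hf0, hf1⟩ := exists_c0_bump 𝕜
    ((N s).usc.isOpen_preimage r) (show x ∈ (N s).toFun ⁻¹' Set.Iio r from hr)
  have hr0 : 0 ≤ r := (N.nonneg s x).trans hr.le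
  refine ⟨f, hV x hxV, N.norm_le hr0 fun y => ?_⟩
  rw [N.smul_eq]
  by_cases hy : N s y < r
  · exact (mul_le_of_le_one_left (N.nonneg s y) (hf1 y)).trans hy.le
  · rw [hf0 y hy, norm_zero, zero_mul]
    exact hr0

/-- The infimum half of the localization formula: bounds by the global norms `‖f • s‖` with `f x =
1` become a bound by the local value `N s x`. -/
theorem le_of_forall_smul (N : U0ValuedNorm Ω 𝕜 Γ) {s : Γ} {x : Ω} {a C : ℝ} (hC : 0 ≤ C)
    (h : ∀ f : C₀(Ω, 𝕜), f x = 1 → a ≤ C * ‖f • s‖) : a ≤ C * N s x := by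
  have h1 : ∀ r, N s x < r → a ≤ C * r := fun r hr => by
    obtain ⟨f, hf, hfs⟩ := N.exists_smul_norm_le hr
    exact (h f hf).trans (mul_le_mul_of_nonneg_left hfs hC)
  have h2 : Tendsto (fun r => C * r) (𝓝[>] (N s x)) (𝓝 (C * N s x)) :=
    (continuous_const.mul continuous_id).continuousAt.mono_left nhdsWithin_le_nhds
  exact ge_of_tendsto h2 (by filter_upwards [self_mem_nhdsWithin] with r hr using h1 r hr)

/-- Scalar homogeneity is not among the axioms of the valued norm. It is recovered by moving the
sign onto a function equal to 1 at `x`. -/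
theorem apply_neg [IsBanachModule 𝕜 C₀(Ω, 𝕜) Γ] (N : U0ValuedNorm Ω 𝕜 Γ) (s : Γ) (x : Ω) :
    N (-s) x = N s x := by
  obtain ⟨f, ⟨V, -, hxV, hV⟩, -, -⟩ := exists_c0_bump 𝕜 isOpen_univ (Set.mem_univ x)
  have hfx := hV x hxV
  have h : f • (-s) = ((-1 : 𝕜) • f) • s := by
    rw [← neg_one_smul 𝕜 s]
    exact (IsBanachModule.smul_scalar (-1 : 𝕜) f s).trans
      (IsBanachModule.scalar_smul (-1 : 𝕜) f s).symm
  have h' := congrArg (fun t => N t x) h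
  simpa [N.smul_eq, hfx] using h'

theorem apply_sub_le [IsBanachModule 𝕜 C₀(Ω, 𝕜) Γ] (N : U0ValuedNorm Ω 𝕜 Γ) (s t : Γ) (x : Ω) :
    N (s - t) x ≤ N s x + N t x := by
  rw [sub_eq_add_neg, ← N.apply_neg t]
  exact N.add_le _ _ _

end U0ValuedNorm

theorem notMem_moduleSupport_of_smul_eq_zero [LocallyCompactSpace Ω] [T2Space Ω] {Γ : Type*}
    [NormedAddCommGroup Γ] [SMul C₀(Ω, 𝕜) Γ] {s : Γ} {x : Ω} {V : Set Ω}
    (hV : IsOpen V) (hx : x ∈ V) (h : ∀ g : C₀(Ω, 𝕜), (∀ y, y ∉ V → g y = 0) → g • s = 0) :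
    x ∉ moduleSupport Ω 𝕜 s := by
  obtain ⟨g, ⟨W, -, hxW, hW⟩, hg0, -⟩ := exists_c0_bump 𝕜 hV hx
  exact fun hs => hs g (by simp [hW x hxW]) (h g hg0)

variable {φ : Ω ≃ₜ Ω} {T : Γ →L[𝕜] Λ}

/-- If `f • s = 0`, then at each `y` either `f y = 0` or `|s|(y) = 0`, and in the latter case `|T
s|(φ y) = 0`. Hence `koopman φ f` annihilates `T s`. -/
theorem moduleSupport_subset_of_apply_le
    (NΓ : U0ValuedNorm Ω 𝕜 Γ) (NΛ : U0ValuedNorm Ω 𝕜 Λ) {m : ℝ}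
    (h : ∀ (s : Γ) (x : Ω), NΛ (T s) x ≤ m * (NΓ s).koopman φ x) (s : Γ) :
    moduleSupport Ω 𝕜 (T s) ⊆ φ '' moduleSupport Ω 𝕜 s := by
  intro x hx
  obtain ⟨x, rfl⟩ := φ.surjective x
  refine ⟨x, fun f hfx hfs => ?_, rfl⟩
  refine hx (koopman φ f) (by rwa [koopman_apply_apply]) (NΛ.eq_zero fun y => ?_)
  obtain ⟨y, rfl⟩ := φ.surjective y
  rw [NΛ.smul_eq, koopman_apply_apply]
  have h1 := NΓ.smul_eq f s y
  rw [hfs, NΓ.apply_zero] at h1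
  rcases mul_eq_zero.1 h1.symm with h2 | h2
  · rw [h2, zero_mul]
  · have h3 := h s (φ y)
    rw [U0.koopman_apply_apply, h2, mul_zero] at h3
    rw [le_antisymm h3 (NΛ.nonneg _ _), mul_zero]

variable [LocallyCompactSpace Ω] [T2Space Ω]

theorem IsKoopmanHom.apply_le (hT : IsKoopmanHom φ T) (NΓ : U0ValuedNorm Ω 𝕜 Γ) (NΛ : U0ValuedNorm Ω 𝕜 Λ)
    (s : Γ) (x : Ω) : NΛ (T s) (φ x) ≤ ‖T‖ * NΓ s x := by
  refine NΓ.le_of_forall_smul (norm_nonneg T) fun f hf => ?_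
  have h1 := NΛ.smul_eq (koopman φ f) (T s) (φ x)
  rw [koopman_apply_apply, hf, norm_one, one_mul, ← hT f s] at h1
  rw [← h1]
  exact (NΛ.le_norm _ _).trans (T.le_opNorm _)

variable [IsBanachModule 𝕜 C₀(Ω, 𝕜) Γ]


/-- An operator that does not enlarge supports is local. -/
theorem apply_smul_eq_zero_of_moduleSupport_subset (NΛ : U0ValuedNorm Ω 𝕜 Λ)
    (hT : ∀ s : Γ, moduleSupport Ω 𝕜 (T s) ⊆ φ '' moduleSupport Ω 𝕜 s) {h : C₀(Ω, 𝕜)} {x : Ω}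
    (hx : h x = 0) (s : Γ) : NΛ (T (h • s)) (φ x) = 0 := by
  have hloc : ∀ t : Γ, x ∉ moduleSupport Ω 𝕜 t → NΛ (T t) (φ x) = 0 := fun t ht =>
    NΛ.apply_eq_zero_of_notMem_moduleSupport fun hk => by
      obtain ⟨y, hy, hyx⟩ := hT t hk
      exact ht (φ.injective hyx ▸ hy)
  have key : ∀ ε : ℝ, 0 < ε → NΛ (T (h • s)) (φ x) ≤ ‖T‖ * (ε * ‖s‖) := by
    intro ε hε
    -- Split `h = (h - f * h) + f * h`: the first part vanishes near `x`, so locality applies, and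
    -- the second has norm at most `ε`.
    obtain ⟨f, ⟨V, hV, hxV, hfV⟩, hf0, hf1⟩ := exists_c0_bump 𝕜 (x := x)
      (U := {y | ‖h y‖ < ε}) (isOpen_lt h.continuous.norm continuous_const) (by simpa [hx] using hε)
    have h1 : NΛ (T ((h - f * h) • s)) (φ x) = 0 := by
      refine hloc _ (notMem_moduleSupport_of_smul_eq_zero hV hxV fun g hg => ?_)
      have : g * (h - f * h) = 0 := by
        ext y
        by_cases hy : y ∈ V
        · simp [hfV y hy]
        · simp [hg y hy]
      rw [← IsBanachModule.mul_smul 𝕜, this, IsBanachModule.zero_smul 𝕜]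
    have h2 : ‖f * h‖ ≤ ε := by
      rw [← ZeroAtInftyContinuousMap.norm_toBCF_eq_norm]
      refine (BoundedContinuousFunction.norm_le hε.le).2 fun y => ?_
      change ‖f y * h y‖ ≤ ε
      rw [norm_mul]
      by_cases hy : ‖h y‖ < ε
      · exact (mul_le_of_le_one_left (norm_nonneg _) (hf1 y)).trans hy.le
      · rw [hf0 y hy, norm_zero, zero_mul]
        exact hε.le
    have h3 : T (h • s) = T ((h - f * h) • s) + T ((f * h) • s) := by
      rw [← map_add, ← IsBanachModule.add_smul 𝕜, sub_add_cancel]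
    calc NΛ (T (h • s)) (φ x)
        ≤ NΛ (T ((h - f * h) • s)) (φ x) + NΛ (T ((f * h) • s)) (φ x) := by
          rw [h3]; exact NΛ.add_le _ _ _
      _ = NΛ (T ((f * h) • s)) (φ x) := by rw [h1, zero_add]
      _ ≤ ‖T ((f * h) • s)‖ := NΛ.le_norm _ _
      _ ≤ ‖T‖ * ‖(f * h) • s‖ := T.le_opNorm _
      _ ≤ ‖T‖ * (ε * ‖s‖) := by
        gcongr
        exact (IsBanachModule.norm_smul_le 𝕜 _ _).trans (by gcongr)
  refine le_antisymm ?_ (NΛ.nonneg _ _)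
  have h2 : Tendsto (fun ε => ‖T‖ * (ε * ‖s‖)) (𝓝[>] (0 : ℝ)) (𝓝 0) := by
    have : Continuous fun ε : ℝ => ‖T‖ * (ε * ‖s‖) := by fun_prop
    simpa using (this.tendsto 0).mono_left nhdsWithin_le_nhds
  exact ge_of_tendsto h2 (by filter_upwards [self_mem_nhdsWithin] with ε hε using key ε hε)

/-- With `e = 1` near `x` standing in for the unit, `f - f x • e` vanishes at `x`, while the support
of `e • s - s` misses `x`. -/
theorem apply_smul_sub_eq_zero_of_moduleSupport_subset (NΛ : U0ValuedNorm Ω 𝕜 Λ)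
    (hT : ∀ s : Γ, moduleSupport Ω 𝕜 (T s) ⊆ φ '' moduleSupport Ω 𝕜 s) (f : C₀(Ω, 𝕜)) (s : Γ)
    (x : Ω) : NΛ (T (f • s) - f x • T s) (φ x) = 0 := by
  obtain ⟨e, ⟨V, hV, hxV, heV⟩, -, -⟩ := exists_c0_bump 𝕜 isOpen_univ (Set.mem_univ x)
  have h1 : NΛ (T ((f - f x • e) • s)) (φ x) = 0 :=
    apply_smul_eq_zero_of_moduleSupport_subset NΛ hT (by simp [heV x hxV]) s
  have h2 : NΛ (T (f x • (e • s - s))) (φ x) = 0 := by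
    refine NΛ.apply_eq_zero_of_notMem_moduleSupport fun hk => ?_
    obtain ⟨y, hy, hyx⟩ := hT _ hk
    rw [φ.injective hyx] at hy
    refine notMem_moduleSupport_of_smul_eq_zero hV hxV (fun g hg => ?_) hy
    have : g * e = g := by
      ext z
      by_cases hz : z ∈ V
      · simp [heV z hz]
      · simp [hg z hz]
    rw [IsBanachModule.smul_scalar, IsBanachModule.smul_sub 𝕜, ← IsBanachModule.mul_smul 𝕜, this,
      sub_self, smul_zero]
  have h3 : T (f • s) - f x • T s = T ((f - f x • e) • s) + T (f x • (e • s - s)) := by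
    have h4 : (f x • e) • s = f x • (e • s) := IsBanachModule.scalar_smul (f x) e s
    rw [← map_smul, ← map_sub, ← map_add, IsBanachModule.sub_smul 𝕜, h4, _root_.smul_sub]
    congr 1
    abel
  refine le_antisymm ?_ (NΛ.nonneg _ _)
  rw [h3]
  exact (NΛ.add_le _ _ _).trans (by rw [h1, h2, add_zero])

variable [IsBanachModule 𝕜 C₀(Ω, 𝕜) Λ]

theorem isKoopmanHom_of_moduleSupport_subset (NΛ : U0ValuedNorm Ω 𝕜 Λ)
    (hT : ∀ s : Γ, moduleSupport Ω 𝕜 (T s) ⊆ φ '' moduleSupport Ω 𝕜 s) : IsKoopmanHom φ T := by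
  intro f s
  rw [← sub_eq_zero]
  refine NΛ.eq_zero fun y => ?_
  obtain ⟨x, rfl⟩ := φ.surjective y
  have h1 := apply_smul_sub_eq_zero_of_moduleSupport_subset NΛ hT f s x
  -- The identity of `Λ` respects supports over the identity of `Ω`, so the same lemma compares
  -- `koopman φ f • T s` with `f x • T s` at `φ x`.
  have h2 := apply_smul_sub_eq_zero_of_moduleSupport_subset (T := ContinuousLinearMap.id 𝕜 Λ)
    (φ := Homeomorph.refl Ω) NΛ (fun t => by simp) (koopman φ f) (T s) (φ x)
  simp only [Homeomorph.refl_apply, id_eq, ContinuousLinearMap.id_apply, koopman_apply_apply] at h2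
  have h3 := NΛ.apply_sub_le (T (f • s) - f x • T s) (koopman φ f • T s - f x • T s) (φ x)
  rw [h1, h2, sub_sub_sub_cancel_right, add_zero] at h3
  exact le_antisymm h3 (NΛ.nonneg _ _)

theorem tfae_isKoopmanHom (NΓ : U0ValuedNorm Ω 𝕜 Γ) (NΛ : U0ValuedNorm Ω 𝕜 Λ) :
    List.TFAE [
      IsKoopmanHom φ T,
      ∀ s : Γ, moduleSupport Ω 𝕜 (T s) ⊆ φ '' moduleSupport Ω 𝕜 s,
      ∀ (s : Γ) (x : Ω), NΛ (T s) x ≤ ‖T‖ * (NΓ s).koopman φ x,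
      ∃ m : ℝ, 0 < m ∧ ∀ (s : Γ) (x : Ω), NΛ (T s) x ≤ m * (NΓ s).koopman φ x] := by
  tfae_have 1 → 3 := fun h s x => by
    obtain ⟨x, rfl⟩ := φ.surjective x
    rw [U0.koopman_apply_apply]
    exact h.apply_le NΓ NΛ s x
  tfae_have 3 → 4 := fun h => ⟨‖T‖ + 1, by positivity, fun s x =>
    (h s x).trans (mul_le_mul_of_nonneg_right (by linarith) (NΓ.nonneg _ _))⟩
  tfae_have 4 → 2 := fun ⟨_, _, h⟩ => moduleSupport_subset_of_apply_le NΓ NΛ h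
  tfae_have 2 → 1 := isKoopmanHom_of_moduleSupport_subset NΛ
  tfae_finish

end

/-! ### Bundle morphisms and weighted Koopman operators -/

namespace BanachBundle

open Topology Filter

variable {𝕜 : Type*} {Ω : Type*} [RCLike 𝕜] [TopologicalSpace Ω]

namespace Morphism

variable {E F : BanachBundle 𝕜 Ω} {φ : Ω ≃ₜ Ω}

/-- At points of the form `φ x` the transport between fibers disappears. The comparison is made in
the total space, where transport does not change a point. -/
theorem weightedKoopman_apply_apply (Φ : Morphism φ E F) (s : E.Gamma0) (x : Ω) :
    Φ.weightedKoopman s (φ x) = Φ.fiberMap x (s x) := by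
  have h : ∀ y, φ.symm (φ x) = y →
      (⟨φ (φ.symm (φ x)), Φ.fiberMap (φ.symm (φ x)) (s (φ.symm (φ x)))⟩ : F.Total)
        = ⟨φ y, Φ.fiberMap y (s y)⟩ := by
    rintro _ rfl; rfl
  have h' : (⟨φ x, Φ.weightedKoopman s (φ x)⟩ : F.Total) = ⟨φ x, Φ.fiberMap x (s x)⟩ :=
    (total_cast _ _).trans (h x (φ.symm_apply_apply x))
  exact Bundle.TotalSpace.mk_injective _ h'

theorem weightedKoopman_eq_of_forall (Φ : Morphism φ E F) {T : E.Gamma0 →L[𝕜] F.Gamma0}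
    (h : ∀ (s : E.Gamma0) (x : Ω), T s (φ x) = Φ.fiberMap x (s x)) : T = Φ.weightedKoopman := by
  ext s y
  obtain ⟨x, rfl⟩ := φ.surjective y
  rw [h, weightedKoopman_apply_apply]

theorem ext_fiberMap {φ : Ω → Ω} {Φ Ψ : Morphism φ E F}
    (h : ∀ (x : Ω) (v : E.Fiber x), Φ.fiberMap x v = Ψ.fiberMap x v) : Φ = Ψ := by
  obtain ⟨a, _, _⟩ := Φ
  obtain ⟨b, _, _⟩ := Ψ
  have : a = b := funext fun x => ContinuousLinearMap.ext (h x)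
  subst this
  rfl

theorem isKoopmanHom (Φ : Morphism φ E F) : IsKoopmanHom φ Φ.weightedKoopman := by
  intro f s
  ext y
  obtain ⟨x, rfl⟩ := φ.surjective y
  rw [weightedKoopman_apply_apply, Gamma0.smul_apply, Gamma0.smul_apply,
    weightedKoopman_apply_apply, koopman_apply_apply, map_smul]

variable [LocallyCompactSpace Ω] [T2Space Ω]

theorem weightedKoopman_injective :
    Function.Injective (weightedKoopman : Morphism φ E F → E.Gamma0 →L[𝕜] F.Gamma0) := by
  intro Φ Ψ h
  refine ext_fiberMap fun x v => ?_
  obtain ⟨s, rfl⟩ := E.exists_section v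
  rw [← weightedKoopman_apply_apply, ← weightedKoopman_apply_apply, h]

theorem norm_weightedKoopman (Φ : Morphism φ E F) : Φ.norm = ‖Φ.weightedKoopman‖ := by
  refine le_antisymm (Real.iSup_le (fun x => ?_) (_root_.norm_nonneg _))
    (LinearMap.mkContinuous_norm_le _ Φ.norm_nonneg _)
  refine ContinuousLinearMap.opNorm_le_bound _ (_root_.norm_nonneg _) fun v => ?_
  -- The section need not have norm close to `‖v‖`: the pointwise bound (c) involves only `‖s x‖`.
  obtain ⟨s, rfl⟩ := E.exists_section v
  rw [← weightedKoopman_apply_apply]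
  exact Φ.isKoopmanHom.apply_le (Gamma0.valuedNorm E) (Gamma0.valuedNorm F) s x

theorem isIsometric_iff (Φ : Morphism φ E F) :
    Φ.IsIsometric ↔ Isometry Φ.weightedKoopman := by
  constructor
  · intro h
    refine AddMonoidHomClass.isometry_of_norm _ fun s => ?_
    rw [Gamma0.norm_def, Gamma0.norm_def, ← φ.toEquiv.iSup_comp]
    refine iSup_congr fun x => ?_
    exact (congrArg _ (weightedKoopman_apply_apply Φ s x)).trans
      ((AddMonoidHomClass.isometry_iff_norm _).1 (h x) (s x))
  · intro h x
    have hn := (AddMonoidHomClass.isometry_iff_norm _).1 h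
    refine AddMonoidHomClass.isometry_of_norm _ fun v => ?_
    obtain ⟨s, rfl⟩ := E.exists_section v
    rw [← weightedKoopman_apply_apply]
    refine le_antisymm ?_ ?_
    · refine (Φ.isKoopmanHom.apply_le (Gamma0.valuedNorm E) (Gamma0.valuedNorm F) s x).trans ?_
      refine mul_le_of_le_one_left (_root_.norm_nonneg (s x)) ?_
      exact ContinuousLinearMap.opNorm_le_bound _ zero_le_one fun t => by rw [hn, one_mul]
    -- For `f (φ x) = 1`, the function `f ∘ φ` is 1 at `x`, so `‖s x‖` is at most the norm of `(f ∘
    -- φ) • s`, which the isometry turns into that of `f • 𝒯_Φ s`. The infimum over `f` localizes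
    -- this at `φ x`.
    · have hle : ‖s x‖ ≤ 1 * Gamma0.valuedNorm F (Φ.weightedKoopman s) (φ x) := by
        refine (Gamma0.valuedNorm F).le_of_forall_smul zero_le_one fun f hf => ?_
        have hk : koopman φ (koopman φ.symm f) = f := by
          ext y
          exact congrArg f (φ.apply_symm_apply y)
        have h1 := Φ.isKoopmanHom (koopman φ.symm f) s
        rw [hk] at h1
        rw [← h1, hn, one_mul]
        have h2 := (koopman φ.symm f • s).norm_apply_le x
        have h3 : koopman φ.symm f x = 1 := hf
        rwa [Gamma0.smul_apply, h3, one_smul] at h2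
      rwa [one_mul] at hle

end Morphism

variable [LocallyCompactSpace Ω] [T2Space Ω] {E F : BanachBundle 𝕜 Ω} {φ : Ω ≃ₜ Ω}

theorem exists_morphism {T : E.Gamma0 →L[𝕜] F.Gamma0} {m : ℝ} (hm : 0 < m)
    (hT : ∀ (s : E.Gamma0) (x : Ω), ‖T s (φ x)‖ ≤ m * ‖s x‖) :
    ∃ Φ : Morphism φ E F, T = Φ.weightedKoopman := by
  choose σ hσ using fun (x : Ω) (v : E.Fiber x) => E.exists_section v
  -- The bound applied to `s - t` shows that `T s (φ x)` depends only on `s x`, so the choice of `σ`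
  -- is immaterial and linearity follows.
  have hwd : ∀ (s t : E.Gamma0) (x : Ω), s x = t x → T s (φ x) = T t (φ x) := by
    intro s t x h
    have h1 := hT (s - t) x
    rw [map_sub, Gamma0.sub_apply, Gamma0.sub_apply, h, sub_self, norm_zero, mul_zero,
      norm_le_zero_iff, sub_eq_zero] at h1
    exact h1
  let L : ∀ x, E.Fiber x →L[𝕜] F.Fiber (φ x) := fun x => LinearMap.mkContinuous
    { toFun := fun v => T (σ x v) (φ x)
      map_add' := fun v w => by
        rw [← Gamma0.add_apply, ← map_add]
        exact hwd _ _ x (by simp [hσ])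
      map_smul' := fun c v => by
        rw [RingHom.id_apply, ← Gamma0.scalar_apply, ← map_smul]
        exact hwd _ _ x (by simp [hσ]) } m fun v => by
      have := hT (σ x v) x
      rwa [hσ] at this
  have hL : ∀ (s : E.Gamma0) (x : Ω), T s (φ x) = L x (s x) := fun s x =>
    hwd _ _ x (hσ x (s x)).symm
  have hLm : ∀ (x : Ω) (v : E.Fiber x), ‖L x v‖ ≤ m * ‖v‖ := fun x v => by
    rw [← hσ x v, ← hL]
    exact hT _ x
  refine ⟨⟨L, ?_, ⟨m, ?_⟩⟩, Morphism.weightedKoopman_eq_of_forall _ hL⟩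
  -- Near `s x` write `L z b = T s (φ z) + L z (b - s z)`: the first term is continuous in `z`, and
  -- the second has norm at most `ε`, so it lies in a tube around zero.
  · refine continuous_iff_continuousAt.2 ?_
    rintro ⟨x, v⟩ O hO
    obtain ⟨s, rfl⟩ := E.exists_section v
    obtain ⟨V, hV, W, hW, hVW⟩ := F.exists_nhds_add_mem (u := T s (φ x)) (w := 0) (O := O)
      (by rw [add_zero, hL]; exact hO)
    obtain ⟨W', hW'W, hW', h0W'⟩ := mem_nhds_iff.1 hW
    obtain ⟨ε, hε, U, hU, hxU, hUW⟩ := F.tube (φ x) W' hW' h0W'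
    obtain ⟨A, hA, B, hB, hAB⟩ := E.exists_nhds_norm_sub_lt (u := s x) (w := s x) (r := ε / m)
      (by simpa using div_pos hε hm)
    have hp := E.tendsto_proj x (s x)
    have hφ : Tendsto φ (𝓝 x) (𝓝 (φ x)) := φ.continuous.tendsto x
    rw [mem_map]
    filter_upwards [hA, hp.eventually (s.continuous.continuousAt hB),
      hp.eventually (hφ (hU.mem_nhds hxU)),
      hp.eventually (hφ ((T s).continuous.continuousAt hV))]
    rintro ⟨z, b⟩ h1 h2 h3 h4
    have h5 : ‖b - s z‖ < ε / m := hAB z b (s z) h1 h2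
    have h6 : ‖L z (b - s z)‖ ≤ ε := (hLm z _).trans ((lt_div_iff₀' hm).1 h5).le
    have h7 := hVW (φ z) (T s (φ z)) (L z (b - s z)) h4 (hW'W (hUW ⟨h3, h6⟩))
    rwa [hL, ← map_add, add_sub_cancel] at h7
  · rintro _ ⟨x, rfl⟩
    exact ContinuousLinearMap.opNorm_le_bound _ hm.le (hLm x)

end BanachBundle

theorem mainTheorem5 {𝕜 : Type*} [RCLike 𝕜] {Ω : Type*} [TopologicalSpace Ω]
    [LocallyCompactSpace Ω] [T2Space Ω] (φ : Ω ≃ₜ Ω) :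
    (∀ (Γ : Type*) (Λ : Type*)
      [NormedAddCommGroup Γ] [NormedSpace 𝕜 Γ] [SMul C₀(Ω, 𝕜) Γ] [IsBanachModule 𝕜 C₀(Ω, 𝕜) Γ]
      [NormedAddCommGroup Λ] [NormedSpace 𝕜 Λ] [SMul C₀(Ω, 𝕜) Λ] [IsBanachModule 𝕜 C₀(Ω, 𝕜) Λ]
      (NΓ : U0ValuedNorm Ω 𝕜 Γ) (NΛ : U0ValuedNorm Ω 𝕜 Λ) (T : Γ →L[𝕜] Λ),
      List.TFAE [
        IsKoopmanHom φ T,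
        ∀ s : Γ, moduleSupport Ω 𝕜 (T s) ⊆ φ '' moduleSupport Ω 𝕜 s,
        ∀ (s : Γ) (x : Ω), NΛ (T s) x ≤ ‖T‖ * (NΓ s).koopman φ x,
        ∃ m : ℝ, 0 < m ∧ ∀ (s : Γ) (x : Ω), NΛ (T s) x ≤ m * (NΓ s).koopman φ x]) ∧
    (∀ (E F : BanachBundle 𝕜 Ω) (T : E.Gamma0 →L[𝕜] F.Gamma0),
      List.TFAE [
        IsKoopmanHom φ T,
        ∀ s : E.Gamma0, moduleSupport Ω 𝕜 (T s) ⊆ φ '' moduleSupport Ω 𝕜 s,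
        ∀ (s : E.Gamma0) (x : Ω), BanachBundle.Gamma0.valuedNorm F (T s) x ≤
          ‖T‖ * (BanachBundle.Gamma0.valuedNorm E s).koopman φ x,
        ∃ m : ℝ, 0 < m ∧ ∀ (s : E.Gamma0) (x : Ω), BanachBundle.Gamma0.valuedNorm F (T s) x ≤
          m * (BanachBundle.Gamma0.valuedNorm E s).koopman φ x,
        ∃ Φ : BanachBundle.Morphism φ E F, T = Φ.weightedKoopman] ∧
      ∀ Φ : BanachBundle.Morphism φ E F, T = Φ.weightedKoopman →
        (∀ Ψ : BanachBundle.Morphism φ E F, T = Ψ.weightedKoopman → Ψ = Φ) ∧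
        Φ.norm = ‖T‖ ∧
        (Φ.IsIsometric ↔ Isometry T)) := by
  refine ⟨fun Γ Λ _ _ _ _ _ _ _ _ NΓ NΛ T => tfae_isKoopmanHom NΓ NΛ, fun E F T => ⟨?_, ?_⟩⟩
  · have h := tfae_isKoopmanHom (φ := φ) (T := T) (BanachBundle.Gamma0.valuedNorm E)
      (BanachBundle.Gamma0.valuedNorm F)
    tfae_have 1 ↔ 2 := h.out 0 1
    tfae_have 1 ↔ 3 := h.out 0 2
    tfae_have 1 ↔ 4 := h.out 0 3
    tfae_have 4 → 5 := fun ⟨m, hm, hT⟩ => BanachBundle.exists_morphism hm fun s x => by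
      have := hT s (φ x)
      rwa [U0.koopman_apply_apply] at this
    tfae_have 5 → 1 := by
      rintro ⟨Φ, rfl⟩
      exact Φ.isKoopmanHom
    tfae_finish
  · rintro Φ rfl
    exact ⟨fun Ψ h => (BanachBundle.Morphism.weightedKoopman_injective h).symm,
      Φ.norm_weightedKoopman, Φ.isIsometric_iff⟩
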